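/- Let $N$ be a lattice of finite rank $d$, let $v_1,\dots,v_k\in N$ ($k\ge 1$) be distinct elements that generate $N$ as a group, and assume that there is a group homomorphism $\deg:N\to\mathbb Z$ with $\deg(v_i)=1$ for all $i$. Let $\Delta\subset N\otimes\mathbb R$ be the convex hull of $v_1,\dots,v_k$, and let $\mathbf\Sigma$ be the simplicial stacky fan induced by a regular triangulation of $\Delta$ whose vertices are among the $v_i$ (not every $v_i$ need be a vertex): its cones are the cones over the simplices of the triangulation, together with $\{0\}$, and $v_i$ is the chosen generator of a ray for each $i$ in the set $I(\mathbf\Sigma)$ of those indices for which $v_i$ is a vertex of the triangulation. Write $\Sigma\subset N\otimes\mathbb R$ for the support (the union of the cones) of the fan. Let $\mathbb C[\mathbf\Sigma]$ be the commutative ring with $\mathbb C$-basis $[n]$, $n\in N\cap\Sigma$, and product $[m]\cdot[n]=[m+n]$ if some cone of the fan contains both $m$ and $n$, and $[m]\cdot[n]=0$ otherwise. For $\chi\in N\otimes\mathbb R$ let $\mathbb C[\mathbf\Sigma;\chi]$ be the $\mathbb C[\mathbf\Sigma]$-module with $\mathbb C$-basis $[n+\chi]$, where $n\in N$ and $n+\chi\in\Sigma$,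 and action $[m]\cdot[n+\chi]=[m+n+\chi]$ if some cone of the fan contains both $m$ and $n+\chi$, and $0$ otherwise. For $\chi,\xi\in N\otimes\mathbb R$ let $\mathbb C[\mathbf\Sigma;\chi]_\xi\subset\mathbb C[\mathbf\Sigma;\chi]$ be the submodule generated by all $[n+\chi]$ with $n\in N$, $n+\chi\in\Sigma$, such that $n+\chi+\varepsilon\xi\in\Sigma$ for all sufficiently small $\varepsilon>0$. Let $(g_1,\dots,g_d)$ be any basis of $\mathrm{Hom}(N,\mathbb Z)$ and let $Z$ be the ideal generated by the elements $Z_j=\sum_{i\in I(\mathbf\Sigma)}g_j(v_i)[v_i]$, $1\le j\le d$. Then for all $\chi,\xi\in N\otimes\mathbb R$ the three quotients $$\mathbb C[\mathbf\Sigma]/Z\cdot\mathbb C[\mathbf\Sigma],\qquad \mathbb C[\mathbf\Sigma;\chi]/Z\cdot\mathbb C[\mathbf\Sigma;\chi],\qquad \mathbb C[\mathbf\Sigma;\chi]_\xi/Z\cdot\mathbb C[\mathbf\Sigma;\chi]_\xi$$ are finite-dimensional complex vector spaces, each of dimension equal to the normalized volume of $\Delta$, that is, $(d-1)!$ times the volume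 of $\Delta$ in its affine hull $\{\deg=1\}$, where Lebesgue measure is scaled so that a fundamental parallelepiped of the lattice $\ker(\deg)$ has volume $1$. -/

import Mathlib

open scoped TensorProduct

namespace StackyGKZ

/-- The real vector space `N ⊗ ℝ`. -/
abbrev RealSpan (N : Type*) [AddCommGroup N] : Type _ := ℝ ⊗[ℤ] N

/-- The canonical map `N → N ⊗ ℝ`, injective when `N` is a lattice. -/
noncomputable def toReal {N : Type*} [AddCommGroup N] : N →ₗ[ℤ] RealSpan N :=
  TensorProduct.mk ℤ ℝ N 1

theorem toReal_apply {N : Type*} [AddCommGroup N] (n : N) : toReal n = (1 : ℝ) ⊗ₜ[ℤ] n := rfl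

/-- The cone `∑_{i ∈ I} ℝ_{≥ 0} v_i` in `N ⊗ ℝ`. -/
def cone {N : Type*} [AddCommGroup N] {k : ℕ} (v : Fin k → N) (I : Finset (Fin k)) :
    Set (RealSpan N) :=
  {x | ∃ a : Fin k → ℝ, (∀ i, 0 ≤ a i) ∧ (∀ i, i ∉ I → a i = 0) ∧
    ∑ i, a i • toReal (v i) = x}

/-- The simplex `conv {v_i : i ∈ I}` in `N ⊗ ℝ`. -/
def simplex {N : Type*} [AddCommGroup N] {k : ℕ} (v : Fin k → N) (I : Finset (Fin k)) :
    Set (RealSpan N) :=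
  convexHull ℝ ((fun i => toReal (v i)) '' (I : Set (Fin k)))

/-- The polytope `Δ = conv {v_1, …, v_k}` in `N ⊗ ℝ`. -/
def polytope {N : Type*} [AddCommGroup N] {k : ℕ} (v : Fin k → N) : Set (RealSpan N) :=
  convexHull ℝ (Set.range fun i => toReal (v i))

/-- A simplicial stacky fan in `N` whose ray generators are some of the vectors `v_1, …, v_k`.
The fan consists of the cones generated by the `v_i`, `i ∈ I`, for `I` in `faces`. -/
structure StackyFan {N : Type*} [AddCommGroup N] {k : ℕ} (v : Fin k → N) where
  /-- The index sets `I(σ)` of the cones `σ` of the fan. -/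
  faces : Set (Finset (Fin k))
  empty_mem : ∅ ∈ faces
  down_closed : ∀ I ∈ faces, ∀ J, J ⊆ I → J ∈ faces
  linearIndepOn : ∀ I ∈ faces, LinearIndepOn ℝ (fun i => toReal (v i)) (I : Set (Fin k))
  inter : ∀ I ∈ faces, ∀ J ∈ faces, cone v I ∩ cone v J = cone v (I ∩ J)

/-- `T` (a family of subsets of the index set of the point configuration `v_1, …, v_k`) is
a regular triangulation of the polytope `Δ = conv {v_1, …, v_k}`. Not every `v_i` has to be a
vertex of the triangulation. -/
structure IsRegularTriangulation {N : Type*} [AddCommGroup N] {k : ℕ} (v : Fin k → N)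
    (T : Set (Finset (Fin k))) : Prop where
  affineIndependent : ∀ I ∈ T, AffineIndependent ℝ (fun i : I => toReal (v i))
  down_closed : ∀ I ∈ T, ∀ J, J ⊆ I → J ∈ T
  covers : ⋃ I ∈ T, simplex v I = polytope v
  inter : ∀ I ∈ T, ∀ J ∈ T, simplex v I ∩ simplex v J = simplex v (I ∩ J)
  /-- The simplices are the projections of the lower faces of the polytope spanned by the lifted
  points `(v_i, ω_i)`: they are the sets on which some affine function `φ + c` with
  `φ (v_i) + c ≤ ω_i` for all `i` attains equality. -/
  regular : ∃ ω : Fin k → ℝ, ∀ I : Finset (Fin k), I ∈ T ↔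
    ∃ (φ : RealSpan N →ₗ[ℝ] ℝ) (c : ℝ),
      (∀ i ∈ I, φ (toReal (v i)) + c = ω i) ∧ ∀ i ∉ I, φ (toReal (v i)) + c < ω i

/-- The sublattice of those elements of `N` that are parallel to the affine hull of `P`. -/
noncomputable def directionLattice {N : Type*} [AddCommGroup N] (P : Set (RealSpan N)) :
    Submodule ℤ N :=
  ((vectorSpan ℝ P).restrictScalars ℤ).comap toReal

/-- `r!` times the Lebesgue measure of the preimage of `P` under the parametrization
`x ↦ p + ∑ x_i b_i` of an affine subspace of `N ⊗ ℝ` by `ℝ^r`. -/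
noncomputable def parametrizedVolume {N : Type*} [AddCommGroup N] {r : ℕ} (p : RealSpan N)
    (b : Fin r → N) (P : Set (RealSpan N)) : ℝ :=
  (Nat.factorial r : ℝ) *
    (MeasureTheory.volume {x : Fin r → ℝ | p + ∑ i, x i • toReal (b i) ∈ P}).toReal

open Classical in
/-- The normalized volume of a (lattice) polytope `P`, not necessarily of full dimension: with
`r = dim P`, it is `r!` times the `r`-dimensional volume of `P` inside its affine hull, where
Lebesgue measure is scaled such that a fundamental parallelepiped of the lattice of elements of
`N` parallel to `P` has volume one. The affine hull is parametrized by `ℝ^r` through a base point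
in `P` and a basis of that lattice; the value does not depend on either. -/
noncomputable def normalizedVolume {N : Type*} [AddCommGroup N] [Module.Free ℤ N]
    [Module.Finite ℤ N] (P : Set (RealSpan N)) : ℝ :=
  if h : P.Nonempty then
    parametrizedVolume h.some (fun i => (Module.finBasis ℤ (directionLattice P) i : N)) P
  else 0

section Cones

variable {N : Type*} [AddCommGroup N] {k : ℕ} {v : Fin k → N}

theorem zero_mem_cone (I : Finset (Fin k)) : (0 : RealSpan N) ∈ cone v I :=
  ⟨0, fun _ => le_rfl, fun _ _ => rfl, by simp⟩

theorem add_mem_cone {I : Finset (Fin k)} {x y : RealSpan N} (hx : x ∈ cone v I)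
    (hy : y ∈ cone v I) : x + y ∈ cone v I := by
  obtain ⟨a, ha, ha', rfl⟩ := hx
  obtain ⟨b, hb, hb', rfl⟩ := hy
  refine ⟨a + b, fun i => add_nonneg (ha i) (hb i), fun i hi => ?_, ?_⟩
  · simp [ha' i hi, hb' i hi]
  · simp [add_smul, Finset.sum_add_distrib]

theorem cone_mono {I J : Finset (Fin k)} (h : I ⊆ J) : cone v I ⊆ cone v J := by
  rintro x ⟨a, ha, ha', rfl⟩
  exact ⟨a, ha, fun i hi => ha' i fun hI => hi (h hI), rfl⟩

theorem mem_cone_of_add_mem (F : StackyFan v) {I J : Finset (Fin k)} (hI : I ∈ F.faces)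
    (hJ : J ∈ F.faces) {x y : RealSpan N} (hx : x ∈ cone v I) (hy : y ∈ cone v I)
    (hxy : x + y ∈ cone v J) : x ∈ cone v J := by
  have hmem : x + y ∈ cone v (I ∩ J) := by
    rw [← F.inter I hI J hJ]; exact ⟨add_mem_cone hx hy, hxy⟩
  obtain ⟨a, ha, ha', rfl⟩ := hx
  obtain ⟨b, hb, hb', rfl⟩ := hy
  obtain ⟨c, hc, hc', h⟩ := hmem
  have hli := linearIndepOn_finset_iff.1 (F.linearIndepOn I hI) (fun i => a i + b i - c i) (by
    have hsum : ∑ i, (a i + b i - c i) • toReal (v i) = 0 := by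
      simp only [sub_smul, add_smul, Finset.sum_sub_distrib, Finset.sum_add_distrib, h, sub_self]
    rw [← hsum]
    refine Finset.sum_subset (Finset.subset_univ I) fun i _ hi => ?_
    rw [ha' i hi, hb' i hi, hc' i fun hm => hi (Finset.mem_inter.1 hm).1]
    simp)
  refine ⟨a, ha, fun i hi => ?_, rfl⟩
  by_cases hiI : i ∈ I
  · have h1 := hli i hiI
    have h2 := hc' i fun hm => hi (Finset.mem_inter.1 hm).2
    have h3 := ha i
    have h4 := hb i
    linarith
  · exact ha' i hiI

end Cones

namespace StackyFan

variable {N : Type*} [AddCommGroup N] {k : ℕ} {v : Fin k → N} (F : StackyFan v)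

/-- The support of the fan, i.e. the union of its cones. -/
def support : Set (RealSpan N) := ⋃ I ∈ F.faces, cone v I

/-- Some cone of the fan contains both `x` and `y`. -/
def Joined (x y : RealSpan N) : Prop := ∃ I ∈ F.faces, x ∈ cone v I ∧ y ∈ cone v I

theorem mem_support {x : RealSpan N} : x ∈ F.support ↔ ∃ I ∈ F.faces, x ∈ cone v I := by
  simp [support]

theorem Joined.symm {F : StackyFan v} {x y : RealSpan N} (h : F.Joined x y) : F.Joined y x := by
  obtain ⟨I, hI, hx, hy⟩ := h
  exact ⟨I, hI, hy, hx⟩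

theorem Joined.add_mem {F : StackyFan v} {x y : RealSpan N} (h : F.Joined x y) :
    x + y ∈ F.support := by
  obtain ⟨I, hI, hx, hy⟩ := h
  exact F.mem_support.2 ⟨I, hI, add_mem_cone hx hy⟩

theorem joined_zero_left {x : RealSpan N} : F.Joined 0 x ↔ x ∈ F.support := by
  rw [mem_support]
  exact ⟨fun ⟨I, hI, _, hx⟩ => ⟨I, hI, hx⟩, fun ⟨I, hI, hx⟩ => ⟨I, hI, zero_mem_cone I, hx⟩⟩

theorem joined_assoc {x y z : RealSpan N} :
    (F.Joined x y ∧ F.Joined (x + y) z) ↔ (F.Joined y z ∧ F.Joined x (y + z)) := by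
  constructor
  · rintro ⟨⟨I, hI, hx, hy⟩, J, hJ, hxy, hz⟩
    have hx' := mem_cone_of_add_mem F hI hJ hx hy hxy
    have hy' := mem_cone_of_add_mem F hI hJ hy hx (by rwa [add_comm])
    exact ⟨⟨J, hJ, hy', hz⟩, J, hJ, hx', add_mem_cone hy' hz⟩
  · rintro ⟨⟨I, hI, hy, hz⟩, J, hJ, hx, hyz⟩
    have hy' := mem_cone_of_add_mem F hI hJ hy hz hyz
    have hz' := mem_cone_of_add_mem F hI hJ hz hy (by rwa [add_comm])
    exact ⟨⟨J, hJ, hx, hy'⟩, J, hJ, add_mem_cone hx hy', hz'⟩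

/-- The underlying vector space of the deformed semigroup ring `ℂ[Σ]`, with basis the elements
of `N ∩ Σ`. -/
def SRRing : Type _ := {n : N // toReal n ∈ F.support} →₀ ℂ

/-- The underlying vector space of the module `ℂ[Σ; χ]`, with basis those `n ∈ N` for which
`n + χ ∈ Σ`. -/
def SRModule (χ : RealSpan N) : Type _ := {n : N // toReal n + χ ∈ F.support} →₀ ℂ

noncomputable instance : AddCommGroup F.SRRing :=
  inferInstanceAs (AddCommGroup ({n : N // toReal n ∈ F.support} →₀ ℂ))

noncomputable instance : Module ℂ F.SRRing :=
  inferInstanceAs (Module ℂ ({n : N // toReal n ∈ F.support} →₀ ℂ))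

noncomputable instance (χ : RealSpan N) : AddCommGroup (F.SRModule χ) :=
  inferInstanceAs (AddCommGroup ({n : N // toReal n + χ ∈ F.support} →₀ ℂ))

noncomputable instance (χ : RealSpan N) : Module ℂ (F.SRModule χ) :=
  inferInstanceAs (Module ℂ ({n : N // toReal n + χ ∈ F.support} →₀ ℂ))

/-- The basis of `ℂ[Σ]` consisting of the `[n]` with `n ∈ N ∩ Σ`. -/
noncomputable def ringBasis : Module.Basis {n : N // toReal n ∈ F.support} ℂ F.SRRing :=
  Module.Basis.ofRepr (LinearEquiv.refl ℂ ({n : N // toReal n ∈ F.support} →₀ ℂ))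

/-- The basis of `ℂ[Σ; χ]` consisting of the `[n + χ]` with `n ∈ N` and `n + χ ∈ Σ`. -/
noncomputable def modBasis (χ : RealSpan N) :
    Module.Basis {n : N // toReal n + χ ∈ F.support} ℂ (F.SRModule χ) :=
  Module.Basis.ofRepr (LinearEquiv.refl ℂ ({n : N // toReal n + χ ∈ F.support} →₀ ℂ))

open Classical in
/-- The basis element `[n]` of `ℂ[Σ]`, for `n ∈ N ∩ Σ` (and `0` for other `n`). -/
noncomputable def mono (n : N) : F.SRRing :=
  if h : toReal n ∈ F.support then F.ringBasis ⟨n, h⟩ else 0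

open Classical in
/-- The basis element `[n + χ]` of `ℂ[Σ; χ]`, for `n ∈ N` with `n + χ ∈ Σ` (and `0` for
other `n`). -/
noncomputable def monoMod (χ : RealSpan N) (n : N) : F.SRModule χ :=
  if h : toReal n + χ ∈ F.support then F.modBasis χ ⟨n, h⟩ else 0

open Classical in
/-- The product of `ℂ[Σ]`: `[m] [n] = [m + n]` if some cone of the fan contains `m` and `n`, and
`[m] [n] = 0` otherwise. -/
noncomputable def mulMap : F.SRRing →ₗ[ℂ] F.SRRing →ₗ[ℂ] F.SRRing :=
  F.ringBasis.constr ℂ fun m => F.ringBasis.constr ℂ fun n =>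
    if F.Joined (toReal m.1) (toReal n.1) then F.mono (m.1 + n.1) else 0

open Classical in
/-- The action of `ℂ[Σ]` on `ℂ[Σ; χ]`: `[m] [n + χ] = [m + n + χ]` if some cone of the fan
contains `m` and `n + χ`, and `[m] [n + χ] = 0` otherwise. -/
noncomputable def actMap (χ : RealSpan N) : F.SRRing →ₗ[ℂ] F.SRModule χ →ₗ[ℂ] F.SRModule χ :=
  F.ringBasis.constr ℂ fun m => (F.modBasis χ).constr ℂ fun n =>
    if F.Joined (toReal m.1) (toReal n.1 + χ) then F.monoMod χ (m.1 + n.1) else 0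

variable {F}

theorem lift_mono {V : Type*} [AddCommGroup V] [Module ℂ V]
    (f : {n : N // toReal n ∈ F.support} → V) {n : N} (h : toReal n ∈ F.support) :
    F.ringBasis.constr ℂ f (F.mono n) = f ⟨n, h⟩ := by
  rw [mono, dif_pos h, Module.Basis.constr_basis]

theorem liftMod_monoMod {χ : RealSpan N} {V : Type*} [AddCommGroup V] [Module ℂ V]
    (f : {n : N // toReal n + χ ∈ F.support} → V) {n : N} (h : toReal n + χ ∈ F.support) :
    (F.modBasis χ).constr ℂ f (F.monoMod χ n) = f ⟨n, h⟩ := by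
  rw [monoMod, dif_pos h, Module.Basis.constr_basis]

theorem ringHom_ext {V : Type*} [AddCommGroup V] [Module ℂ V] {f g : F.SRRing →ₗ[ℂ] V}
    (h : ∀ n, toReal n ∈ F.support → f (F.mono n) = g (F.mono n)) : f = g := by
  refine F.ringBasis.ext fun n => ?_
  have h1 := h n.1 n.2
  rw [mono, dif_pos n.2] at h1
  exact h1

theorem modHom_ext {χ : RealSpan N} {V : Type*} [AddCommGroup V] [Module ℂ V]
    {f g : F.SRModule χ →ₗ[ℂ] V}
    (h : ∀ n, toReal n + χ ∈ F.support → f (F.monoMod χ n) = g (F.monoMod χ n)) : f = g := by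
  refine (F.modBasis χ).ext fun n => ?_
  have h1 := h n.1 n.2
  rw [monoMod, dif_pos n.2] at h1
  exact h1

open Classical in
theorem mulMap_mono {m n : N} (hm : toReal m ∈ F.support) (hn : toReal n ∈ F.support) :
    F.mulMap (F.mono m) (F.mono n) =
      if F.Joined (toReal m) (toReal n) then F.mono (m + n) else 0 := by
  rw [mulMap, lift_mono _ hm, lift_mono _ hn]

open Classical in
theorem actMap_mono {χ : RealSpan N} {m n : N} (hm : toReal m ∈ F.support)
    (hn : toReal n + χ ∈ F.support) :
    F.actMap χ (F.mono m) (F.monoMod χ n) =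
      if F.Joined (toReal m) (toReal n + χ) then F.monoMod χ (m + n) else 0 := by
  rw [actMap, lift_mono _ hm, liftMod_monoMod _ hn]

theorem zero_mem_support : toReal (0 : N) ∈ F.support := by
  rw [map_zero]
  exact F.mem_support.2 ⟨∅, F.empty_mem, zero_mem_cone ∅⟩

theorem mulMap_one (a : F.SRRing) : F.mulMap (F.mono 0) a = a := by
  have h : F.mulMap (F.mono 0) = LinearMap.id := ringHom_ext fun n hn => by
    rw [mulMap_mono zero_mem_support hn, map_zero, if_pos (F.joined_zero_left.2 hn), zero_add,
      LinearMap.id_apply]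
  rw [h, LinearMap.id_apply]

theorem actMap_one {χ : RealSpan N} (a : F.SRModule χ) : F.actMap χ (F.mono 0) a = a := by
  have h : F.actMap χ (F.mono 0) = LinearMap.id := modHom_ext fun n hn => by
    rw [actMap_mono zero_mem_support hn, map_zero, if_pos (F.joined_zero_left.2 hn), zero_add,
      LinearMap.id_apply]
  rw [h, LinearMap.id_apply]

theorem mulMap_comm (a b : F.SRRing) : F.mulMap a b = F.mulMap b a := by
  have h : F.mulMap = F.mulMap.flip := ringHom_ext fun m hm => ringHom_ext fun n hn => by
    rw [LinearMap.flip_apply, mulMap_mono hm hn, mulMap_mono hn hm, add_comm n m]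
    by_cases h : F.Joined (toReal m) (toReal n)
    · rw [if_pos h, if_pos h.symm]
    · rw [if_neg h, if_neg fun h' => h h'.symm]
  exact congrArg (fun f => f a b) h

theorem actMap_mulMap {χ : RealSpan N} (a b : F.SRRing) (x : F.SRModule χ) :
    F.actMap χ (F.mulMap a b) x = F.actMap χ a (F.actMap χ b x) := by
  have h : F.mulMap.compr₂ (F.actMap χ) =
      (LinearMap.llcomp ℂ (F.SRModule χ) (F.SRModule χ) (F.SRModule χ)).compl₁₂
        (F.actMap χ) (F.actMap χ) :=
    ringHom_ext fun l hl => ringHom_ext fun m hm => modHom_ext fun n hn => by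
      simp only [LinearMap.compr₂_apply, LinearMap.compl₁₂_apply, LinearMap.llcomp_apply]
      rw [mulMap_mono hl hm, actMap_mono hm hn]
      have key := F.joined_assoc (x := toReal l) (y := toReal m) (z := toReal n + χ)
      by_cases h1 : F.Joined (toReal l) (toReal m)
      · have hlm : toReal (l + m) ∈ F.support := by rw [map_add]; exact h1.add_mem
        rw [if_pos h1, actMap_mono hlm hn]
        by_cases h2 : F.Joined (toReal (l + m)) (toReal n + χ)
        · obtain ⟨h3, h4⟩ := key.1 ⟨h1, by rwa [map_add] at h2⟩
          have hmn : toReal (m + n) + χ ∈ F.support := by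
            rw [map_add, add_assoc]; exact h3.add_mem
          rw [if_pos h2, if_pos h3, actMap_mono hl hmn, if_pos, add_assoc]
          rw [map_add, add_assoc]; exact h4
        · rw [if_neg h2]
          by_cases h3 : F.Joined (toReal m) (toReal n + χ)
          · have hmn : toReal (m + n) + χ ∈ F.support := by
              rw [map_add, add_assoc]; exact h3.add_mem
            rw [if_pos h3, actMap_mono hl hmn, if_neg]
            intro h4
            rw [map_add, add_assoc] at h4
            exact h2 (by rw [map_add]; exact (key.2 ⟨h3, h4⟩).2)
          · rw [if_neg h3, map_zero]
      · rw [if_neg h1, map_zero, LinearMap.zero_apply]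
        by_cases h3 : F.Joined (toReal m) (toReal n + χ)
        · have hmn : toReal (m + n) + χ ∈ F.support := by
            rw [map_add, add_assoc]; exact h3.add_mem
          rw [if_pos h3, actMap_mono hl hmn, if_neg]
          intro h4
          rw [map_add, add_assoc] at h4
          exact h1 (key.2 ⟨h3, h4⟩).1
        · rw [if_neg h3, map_zero]
  exact congrArg (fun f => f a b x) h

theorem mulMap_assoc (a b c : F.SRRing) :
    F.mulMap (F.mulMap a b) c = F.mulMap a (F.mulMap b c) := by
  have h : F.mulMap.compr₂ F.mulMap =
      (LinearMap.llcomp ℂ F.SRRing F.SRRing F.SRRing).compl₁₂ F.mulMap F.mulMap :=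
    ringHom_ext fun l hl => ringHom_ext fun m hm => ringHom_ext fun n hn => by
      simp only [LinearMap.compr₂_apply, LinearMap.compl₁₂_apply, LinearMap.llcomp_apply]
      rw [mulMap_mono hl hm, mulMap_mono hm hn]
      have key := F.joined_assoc (x := toReal l) (y := toReal m) (z := toReal n)
      by_cases h1 : F.Joined (toReal l) (toReal m)
      · have hlm : toReal (l + m) ∈ F.support := by rw [map_add]; exact h1.add_mem
        rw [if_pos h1, mulMap_mono hlm hn]
        by_cases h2 : F.Joined (toReal (l + m)) (toReal n)
        · obtain ⟨h3, h4⟩ := key.1 ⟨h1, by rwa [map_add] at h2⟩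
          have hmn : toReal (m + n) ∈ F.support := by rw [map_add]; exact h3.add_mem
          rw [if_pos h2, if_pos h3, mulMap_mono hl hmn, if_pos, add_assoc]
          rw [map_add]; exact h4
        · rw [if_neg h2]
          by_cases h3 : F.Joined (toReal m) (toReal n)
          · have hmn : toReal (m + n) ∈ F.support := by rw [map_add]; exact h3.add_mem
            rw [if_pos h3, mulMap_mono hl hmn, if_neg]
            intro h4
            rw [map_add] at h4
            exact h2 (by rw [map_add]; exact (key.2 ⟨h3, h4⟩).2)
          · rw [if_neg h3, map_zero]
      · rw [if_neg h1, map_zero, LinearMap.zero_apply]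
        by_cases h3 : F.Joined (toReal m) (toReal n)
        · have hmn : toReal (m + n) ∈ F.support := by rw [map_add]; exact h3.add_mem
          rw [if_pos h3, mulMap_mono hl hmn, if_neg]
          intro h4
          rw [map_add] at h4
          exact h1 (key.2 ⟨h3, h4⟩).1
        · rw [if_neg h3, map_zero]
  exact congrArg (fun f => f a b c) h

variable (F)

/-- The ring structure of `ℂ[Σ]`. -/
noncomputable instance : CommRing F.SRRing where
  mul a b := F.mulMap a b
  one := F.mono 0
  left_distrib a b c := map_add (F.mulMap a) b c
  right_distrib a b c := F.mulMap.map_add₂ a b c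
  zero_mul a := F.mulMap.map_zero₂ a
  mul_zero a := map_zero (F.mulMap a)
  mul_assoc := mulMap_assoc
  one_mul := mulMap_one
  mul_one a := (mulMap_comm a (F.mono 0)).trans (mulMap_one a)
  mul_comm := mulMap_comm
  neg_add_cancel := neg_add_cancel
  sub_eq_add_neg := sub_eq_add_neg
  zsmul := fun z a => z • a
  zsmul_zero' := SubNegMonoid.zsmul_zero'
  zsmul_succ' := SubNegMonoid.zsmul_succ'
  zsmul_neg' := SubNegMonoid.zsmul_neg'
  nsmul := fun z a => z • a
  nsmul_zero := AddMonoid.nsmul_zero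
  nsmul_succ := AddMonoid.nsmul_succ

noncomputable instance : Algebra ℂ F.SRRing :=
  Algebra.ofModule (fun c a b => F.mulMap.map_smul₂ c a b) (fun c a b => map_smul (F.mulMap a) c b)

/-- The `ℂ[Σ]`-module structure of `ℂ[Σ; χ]`. -/
noncomputable instance (χ : RealSpan N) : Module F.SRRing (F.SRModule χ) where
  smul a x := F.actMap χ a x
  one_smul := actMap_one
  mul_smul := actMap_mulMap
  smul_zero a := map_zero (F.actMap χ a)
  smul_add a x y := map_add (F.actMap χ a) x y
  add_smul a b x := (F.actMap χ).map_add₂ a b x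
  zero_smul x := (F.actMap χ).map_zero₂ x

instance (χ : RealSpan N) : IsScalarTower ℂ F.SRRing (F.SRModule χ) where
  smul_assoc c a x := (F.actMap χ).map_smul₂ c a x

/-- The shadow module `ℂ[Σ; χ]_ξ`: the submodule of `ℂ[Σ; χ]` generated by the `[n + χ]` with
`n + χ ∈ Σ` such that `n + χ + ε ξ ∈ Σ` for all sufficiently small `ε > 0`. -/
noncomputable def shadow (χ ξ : RealSpan N) : Submodule F.SRRing (F.SRModule χ) :=
  Submodule.span F.SRRing {x | ∃ n : N, toReal n + χ ∈ F.support ∧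
    (∀ᶠ ε : ℝ in nhdsWithin 0 (Set.Ioi 0), toReal n + χ + ε • ξ ∈ F.support) ∧
    x = F.monoMod χ n}

open Classical in
/-- The ideal `Z` of `ℂ[Σ]` generated by the elements `Z_j = ∑ g_j(v_i) [v_i]`, where `i` runs
over the indices for which `v_i` generates a ray of the fan. -/
noncomputable def idealZ {d : ℕ} (g : Fin d → Module.Dual ℤ N) : Ideal F.SRRing :=
  Ideal.span (Set.range fun j => ∑ i with {i} ∈ F.faces, (g j (v i) : ℂ) • F.mono (v i))

end StackyFan

end StackyGKZ

namespace StackyGKZ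

open MvPolynomial in
theorem finrank_quotient_of_bijective {R M Γ : Type*} {d : ℕ} [CommRing R] [Algebra ℂ R]
    [AddCommGroup M] [Module R M] [Module ℂ M] [IsScalarTower ℂ R M] [Fintype Γ]
    (z : Fin d → R) (b : Γ → M)
    (hb : Function.Bijective fun p : Γ → MvPolynomial (Fin d) ℂ => ∑ γ, aeval z (p γ) • b γ) :
    Module.Finite ℂ (M ⧸ (Ideal.span (Set.range z) • ⊤ : Submodule R M)) ∧
      Module.finrank ℂ (M ⧸ (Ideal.span (Set.range z) • ⊤ : Submodule R M)) =
        Fintype.card Γ := by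
  let Φ : (Γ → MvPolynomial (Fin d) ℂ) →ₗ[ℂ] M :=
    { toFun := fun p => ∑ γ, aeval z (p γ) • b γ
      map_add' := fun p q => by simp [add_smul, Finset.sum_add_distrib]
      map_smul' := fun c p => by simp [Finset.smul_sum] }
  let e : (Γ → MvPolynomial (Fin d) ℂ) ≃ₗ[ℂ] M := LinearEquiv.ofBijective Φ hb
  let ε : (Γ → MvPolynomial (Fin d) ℂ) →ₗ[ℂ] (Γ → ℂ) :=
    { toFun := fun p γ => constantCoeff (p γ)
      map_add' := fun p q => by ext; simp
      map_smul' := fun c p => by ext; simp [smul_eq_C_mul] }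
  let f : M →ₗ[ℂ] (Γ → ℂ) := ε ∘ₗ e.symm.toLinearMap
  have hε : Function.Surjective ε := fun c => ⟨fun γ => C (c γ), by ext; simp [ε]⟩
  have hf : Function.Surjective f := hε.comp e.symm.surjective
  have hfe : ∀ p, f (Φ p) = ε p := fun p => congrArg ε (e.symm_apply_apply p)
  have hconst : ∀ p : MvPolynomial (Fin d) ℂ,
      aeval z p - algebraMap ℂ R (constantCoeff p) ∈ Ideal.span (Set.range z) := fun p => by
    induction p using MvPolynomial.induction_on with
    | C a => simp
    | add p q hp hq =>
      have := add_mem hp hq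
      simp only [map_add]
      convert this using 1
      ring
    | mul_X p i _ =>
      simp only [map_mul, aeval_X, constantCoeff_X, mul_zero, map_zero, sub_zero]
      exact Ideal.mul_mem_left _ _ (Ideal.subset_span ⟨i, rfl⟩)
  have hker : LinearMap.ker f =
      (Ideal.span (Set.range z) • ⊤ : Submodule R M).restrictScalars ℂ := by
    ext m
    rw [LinearMap.mem_ker, Submodule.restrictScalars_mem]
    constructor
    · intro h
      obtain ⟨p, rfl⟩ := hb.2 m
      have h' : ε p = 0 := by rw [← hfe]; exact h
      refine Submodule.sum_mem _ fun γ _ => Submodule.smul_mem_smul ?_ trivial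
      have h1 := hconst (p γ)
      have h2 : constantCoeff (p γ) = 0 := congrFun h' γ
      simpa [h2] using h1
    · intro h
      induction h using Submodule.smul_induction_on' with
      | smul r hr m hm =>
        clear hm
        induction hr using Submodule.span_induction generalizing m with
        | mem x hx =>
          obtain ⟨j, rfl⟩ := hx
          obtain ⟨p, rfl⟩ := hb.2 m
          have : z j • ∑ γ, aeval z (p γ) • b γ = Φ (fun γ => X j * p γ) := by
            simp [Φ, Finset.smul_sum, mul_smul]
          simp only [this, hfe]
          ext γ
          simp [ε]
        | zero => simp
        | add x y _ _ hx hy => rw [add_smul, map_add, hx, hy, add_zero]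
        | smul a x _ hx => rw [smul_eq_mul, mul_comm, mul_smul]; exact hx _
      | add x _ y _ hx hy => rw [map_add, hx, hy, add_zero]
  let E : (M ⧸ (Ideal.span (Set.range z) • ⊤ : Submodule R M)) ≃ₗ[ℂ] (Γ → ℂ) :=
    (Submodule.Quotient.restrictScalarsEquiv ℂ _).symm ≪≫ₗ
      (Submodule.quotEquivOfEq _ _ hker.symm) ≪≫ₗ f.quotKerEquivOfSurjective hf
  exact ⟨Module.Finite.equiv E.symm, by rw [E.finrank_eq, Module.finrank_fintype_fun_eq_card]⟩

theorem eq_top_of_triangular {R M K : Type*} {d k : ℕ} [CommRing R] [Algebra ℂ R]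
    [AddCommGroup M] [Module R M] [Module ℂ M] [IsScalarTower ℂ R M] [Fintype K]
    {Γ : K → Type*} (I : K → Finset (Fin k)) (h : K → ℝ)
    (e : Module.Basis (Σ σ, Γ σ × (I σ →₀ ℕ)) ℂ M) (x : Fin k → R)
    (A : Fin d → Fin k → ℂ) (c : K → Fin k → Fin d → ℂ)
    (hcA : ∀ σ, ∀ i ∈ I σ, ∀ i' ∈ I σ, ∑ j, c σ i j * A j i' = if i = i' then 1 else 0)
    (hin : ∀ σ γ m (i : I σ), x i • e ⟨σ, γ, m⟩ = e ⟨σ, γ, m + Finsupp.single i 1⟩)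
    (hout : ∀ σ γ m, ∀ i ∉ I σ, x i • e ⟨σ, γ, m⟩ ∈
      Submodule.span ℂ {y | ∃ σ' γ' m', h σ' < h σ ∧ y = e ⟨σ', γ', m'⟩})
    (T : Submodule ℂ M) (hzero : ∀ σ γ, e ⟨σ, γ, 0⟩ ∈ T)
    (hstab : ∀ y ∈ T, ∀ j, (∑ i, A j i • x i) • y ∈ T) : T = ⊤ := by
  classical
  set z : Fin d → R := fun j => ∑ i, A j i • x i with hz
  have hzs : ∀ j (y : M), z j • y = ∑ i, A j i • x i • y := fun j y => by
    simp [hz, Finset.sum_smul, smul_assoc]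
  have hgen : ∀ n : ℕ, ∀ σ, (Finset.univ.filter fun σ' => h σ' < h σ).card = n →
      ∀ γ m, e ⟨σ, γ, m⟩ ∈ T := by
    intro n
    induction n using Nat.strong_induction_on with
    | _ n ih =>
      intro σ hσ γ m
      have hlow : Submodule.span ℂ {y | ∃ σ' γ' m', h σ' < h σ ∧ y = e ⟨σ', γ', m'⟩} ≤
          T := by
        rw [Submodule.span_le]
        rintro _ ⟨σ', γ', m', hlt, rfl⟩
        refine ih _ (hσ ▸ Finset.card_lt_card ⟨fun τ hτ => ?_, fun hsub => ?_⟩) σ' rfl γ' m'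
        · simp only [Finset.mem_filter, Finset.mem_univ, true_and] at hτ ⊢
          linarith
        · have := hsub (show σ' ∈ _ by simpa using hlt)
          simp at this
      induction hm : m.degree generalizing m with
      | zero =>
        rw [Finsupp.degree_eq_zero_iff] at hm
        subst hm
        exact hzero σ γ
      | succ t iht =>
        obtain ⟨i, hi⟩ : ∃ i, m i ≠ 0 := by
          by_contra! hall
          rw [(Finsupp.ext hall : m = 0)] at hm
          simp at hm
        have hle : Finsupp.single i 1 ≤ m := by
          rw [Finsupp.single_le_iff]
          omega
        obtain ⟨m', rfl⟩ : ∃ m', m = m' + Finsupp.single i 1 :=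
          ⟨m - Finsupp.single i 1, (tsub_add_cancel_of_le hle).symm⟩
        have hm' := iht m' (by simpa using hm)
        have key : ∑ j, c σ i j • z j • e ⟨σ, γ, m'⟩ = x i • e ⟨σ, γ, m'⟩ +
            ∑ i' ∈ (I σ)ᶜ, (∑ j, c σ i j * A j i') • x i' • e ⟨σ, γ, m'⟩ := by
          have : ∑ j, c σ i j • z j • e ⟨σ, γ, m'⟩ =
              ∑ i', (∑ j, c σ i j * A j i') • x i' • e ⟨σ, γ, m'⟩ := by
            simp only [hzs, Finset.smul_sum, Finset.sum_smul, mul_smul]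
            exact Finset.sum_comm
          rw [this, ← Finset.sum_add_sum_compl (I σ)]
          congr 1
          rw [Finset.sum_eq_single i.1]
          · rw [hcA σ i i.2 i i.2, if_pos rfl, one_smul]
          · intro i' hi' hne
            rw [hcA σ i i.2 i' hi', if_neg hne.symm, zero_smul]
          · exact fun hi => absurd i.2 hi
        rw [← hin, ← add_sub_cancel_right (x i • e ⟨σ, γ, m'⟩) (∑ i' ∈ (I σ)ᶜ, _), ← key]
        refine sub_mem (Submodule.sum_mem _ fun j _ => Submodule.smul_mem _ _ (hstab _ hm' j))
          (Submodule.sum_mem _ fun i' hi' => Submodule.smul_mem _ _ (hlow ?_))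
        exact hout σ γ m' i' (by simpa using hi')
  rw [eq_top_iff, ← e.span_eq, Submodule.span_le]
  rintro _ ⟨⟨σ, γ, m⟩, rfl⟩
  exact hgen _ σ rfl γ m

open MvPolynomial in
theorem bijective_of_triangular {R M K : Type*} {d k : ℕ} [CommRing R] [Algebra ℂ R]
    [AddCommGroup M] [Module R M] [Module ℂ M] [IsScalarTower ℂ R M] [Fintype K]
    {Γ : K → Type*} [∀ σ, Fintype (Γ σ)] (I : K → Finset (Fin k)) (h : K → ℝ)
    (e : Module.Basis (Σ σ, Γ σ × (I σ →₀ ℕ)) ℂ M) (x : Fin k → R)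
    (A : Fin d → Fin k → ℂ) (c : K → Fin k → Fin d → ℂ)
    (hcA : ∀ σ, ∀ i ∈ I σ, ∀ i' ∈ I σ, ∑ j, c σ i j * A j i' = if i = i' then 1 else 0)
    (hAc : ∀ σ j j', ∑ i : I σ, A j i * c σ i j' = if j = j' then 1 else 0)
    (hin : ∀ σ γ m (i : I σ), x i • e ⟨σ, γ, m⟩ = e ⟨σ, γ, m + Finsupp.single i 1⟩)
    (hout : ∀ σ γ m, ∀ i ∉ I σ, x i • e ⟨σ, γ, m⟩ ∈
      Submodule.span ℂ {y | ∃ σ' γ' m', h σ' < h σ ∧ y = e ⟨σ', γ', m'⟩}) :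
    Function.Bijective fun p : (Σ σ, Γ σ) → MvPolynomial (Fin d) ℂ =>
      ∑ γ, aeval (fun j => ∑ i, A j i • x i) (p γ) • e ⟨γ.1, γ.2, 0⟩ := by
  classical
  set z : Fin d → R := fun j => ∑ i, A j i • x i with hz
  have hzs : ∀ j (y : M), z j • y = ∑ i, A j i • x i • y := fun j y => by
    simp [hz, Finset.sum_smul, smul_assoc]
  let Φ : ((Σ σ, Γ σ) → MvPolynomial (Fin d) ℂ) →ₗ[ℂ] M :=
    { toFun := fun p => ∑ γ, aeval z (p γ) • e ⟨γ.1, γ.2, 0⟩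
      map_add' := fun p q => by simp [add_smul, Finset.sum_add_distrib]
      map_smul' := fun c p => by simp [Finset.smul_sum] }
  constructor
  · change Function.Injective Φ
    rw [injective_iff_map_eq_zero]
    intro p hp
    by_contra hne
    let B : Finset (Σ σ, Γ σ) := Finset.univ.filter fun γ => p γ ≠ 0
    have hB : B.Nonempty := by
      obtain ⟨γ, hγ⟩ := Function.ne_iff.1 hne
      exact ⟨γ, by simpa [B] using hγ⟩
    obtain ⟨⟨σ, γ⟩, hγ, hmax⟩ := B.exists_max_image (fun γ => h γ.1) hB
    let π : M →ₗ[ℂ] MvPolynomial (I σ) ℂ := e.constr ℂ fun y =>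
      if hy : y.1 = σ then if hy ▸ y.2.1 = γ then monomial (hy ▸ y.2.2) 1 else 0 else 0
    have hπ1 : ∀ γ' m, π (e ⟨σ, γ', m⟩) = if γ' = γ then monomial m 1 else 0 := fun γ' m => by
      simp [π, Module.Basis.constr_basis]
    have hπ2 : ∀ σ' γ' m, σ' ≠ σ → π (e ⟨σ', γ', m⟩) = 0 := fun σ' γ' m hσ => by
      simp [π, Module.Basis.constr_basis, hσ]
    let W : Submodule ℂ M :=
      Submodule.span ℂ {y | ∃ σ' γ' m', h σ' ≤ h σ ∧ y = e ⟨σ', γ', m'⟩}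
    have hlow : ∀ σ', h σ' ≤ h σ →
        Submodule.span ℂ {y | ∃ σ'' γ' m', h σ'' < h σ' ∧ y = e ⟨σ'', γ', m'⟩} ≤
          W ⊓ LinearMap.ker π := fun σ' hσ' => by
      rw [Submodule.span_le]
      rintro _ ⟨σ'', γ', m', hlt, rfl⟩
      refine ⟨Submodule.subset_span ⟨σ'', γ', m', by linarith, rfl⟩, ?_⟩
      exact hπ2 _ _ _ (by rintro rfl; linarith)
    have hx : ∀ y ∈ W, ∀ i, x i • y ∈ W ∧
        π (x i • y) = if hi : i ∈ I σ then X ⟨i, hi⟩ * π y else 0 := by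
      intro y hy i
      induction hy using Submodule.span_induction with
      | mem y hy =>
        obtain ⟨σ', γ', m, hle, rfl⟩ := hy
        by_cases hi : i ∈ I σ'
        · rw [hin σ' γ' m ⟨i, hi⟩]
          refine ⟨Submodule.subset_span ⟨_, _, _, hle, rfl⟩, ?_⟩
          by_cases hσ : σ' = σ
          · subst hσ
            rw [hπ1, hπ1, dif_pos hi]
            split_ifs
            · rw [add_comm, X, monomial_mul, one_mul]
            · simp
          · rw [hπ2 _ _ _ hσ, hπ2 _ _ _ hσ]
            simp
        · obtain ⟨h1, h2⟩ := hlow σ' hle (hout σ' γ' m i hi)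
          refine ⟨h1, ?_⟩
          rw [LinearMap.mem_ker.1 h2]
          by_cases hσ : σ' = σ
          · subst hσ
            rw [dif_neg hi]
          · rw [hπ2 _ _ _ hσ]
            simp
      | zero => simp
      | add y y' _ _ hy hy' =>
        rw [smul_add, map_add, map_add, hy.2, hy'.2]
        refine ⟨add_mem hy.1 hy'.1, ?_⟩
        split_ifs
        · rw [mul_add]
        · simp
      | smul a y _ hy =>
        rw [smul_comm (x i) a y, LinearMap.map_smul π a, LinearMap.map_smul π a, hy.2]
        refine ⟨Submodule.smul_mem _ _ hy.1, ?_⟩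
        split_ifs
        · rw [mul_smul_comm]
        · simp
    let θ : MvPolynomial (Fin d) ℂ →ₐ[ℂ] MvPolynomial (I σ) ℂ :=
      aeval fun j => ∑ i : I σ, C (A j i) * X i
    have hzW : ∀ y ∈ W, ∀ j, z j • y ∈ W ∧ π (z j • y) = θ (X j) * π y := fun y hy j => by
      rw [hzs]
      refine ⟨Submodule.sum_mem _ fun i _ => Submodule.smul_mem _ _ (hx y hy i).1, ?_⟩
      simp only [map_sum, map_smul, (hx y hy _).2, θ, aeval_X, Finset.sum_mul]
      rw [← Finset.sum_subset (Finset.subset_univ (I σ)), ← Finset.sum_coe_sort]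
      · refine Finset.sum_congr rfl fun i _ => ?_
        rw [dif_pos i.2, smul_eq_C_mul, mul_assoc]
      · intro i _ hi
        simp [hi]
    have hpW : ∀ q : MvPolynomial (Fin d) ℂ, ∀ y ∈ W,
        aeval z q • y ∈ W ∧ π (aeval z q • y) = θ q * π y := fun q => by
      induction q using MvPolynomial.induction_on with
      | C a =>
        intro y hy
        simp only [algHom_C, algebraMap_smul, map_smul]
        exact ⟨W.smul_mem _ hy, by rw [algebraMap_eq, smul_eq_C_mul]⟩
      | add q q' hq hq' =>
        intro y hy
        simp only [map_add, add_smul, (hq y hy).2, (hq' y hy).2, add_mul, and_true]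
        exact add_mem (hq y hy).1 (hq' y hy).1
      | mul_X q j hq =>
        intro y hy
        obtain ⟨h1, h2⟩ := hzW y hy j
        obtain ⟨h3, h4⟩ := hq _ h1
        rw [map_mul, map_mul, aeval_X, mul_smul]
        exact ⟨h3, by rw [h4, h2, mul_assoc]⟩
    have hθ : Function.Injective θ := by
      let ψ : MvPolynomial (I σ) ℂ →ₐ[ℂ] MvPolynomial (Fin d) ℂ :=
        aeval fun i => ∑ j, C (c σ i j) * X j
      have : ψ.comp θ = AlgHom.id ℂ _ := by
        ext1 j
        simp only [AlgHom.comp_apply, θ, ψ, aeval_X, map_sum, map_mul, algHom_C, algebraMap_eq,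
          AlgHom.id_apply, Finset.mul_sum]
        rw [Finset.sum_comm]
        simp only [← mul_assoc, ← C_mul, ← Finset.sum_mul, ← map_sum, hAc]
        simp [Finset.sum_ite_eq, apply_ite, ite_mul]
      exact Function.LeftInverse.injective (g := ψ) fun q => congrArg (fun f => f q) this
    have hsum : π (Φ p) = θ (p ⟨σ, γ⟩) := by
      change π (∑ γ', aeval z (p γ') • e ⟨γ'.1, γ'.2, 0⟩) = _
      rw [map_sum, Finset.sum_eq_single ⟨σ, γ⟩]
      · rw [(hpW _ _ (Submodule.subset_span ⟨_, _, _, le_rfl, rfl⟩)).2, hπ1, if_pos rfl]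
        simp
      · rintro ⟨σ', γ'⟩ _ hne'
        by_cases h0 : p ⟨σ', γ'⟩ = 0
        · simp [h0]
        · rw [(hpW _ _ (Submodule.subset_span
            ⟨_, _, _, hmax ⟨σ', γ'⟩ (by simpa [B] using h0), rfl⟩)).2]
          by_cases hσ : σ' = σ
          · subst hσ
            rw [hπ1, if_neg (by rintro rfl; exact hne' rfl), mul_zero]
          · rw [hπ2 _ _ _ hσ, mul_zero]
      · simp
    rw [hp, map_zero] at hsum
    have : p ⟨σ, γ⟩ = 0 := hθ (by rw [← hsum, map_zero])
    simp [B, this] at hγ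
  · change Function.Surjective Φ
    rw [← LinearMap.range_eq_top]
    have hstab : ∀ y ∈ LinearMap.range Φ, ∀ j, z j • y ∈ LinearMap.range Φ := by
      rintro _ ⟨p, rfl⟩ j
      exact ⟨fun γ => X j * p γ, by simp [Φ, Finset.smul_sum, mul_smul]⟩
    refine eq_top_of_triangular I h e x A c hcA hin hout _ (fun σ γ => ?_) hstab
    refine ⟨fun γ' => if γ' = ⟨σ, γ⟩ then 1 else 0, ?_⟩
    rw [show Φ = { toFun := _, map_add' := _, map_smul' := _ } from rfl, LinearMap.coe_mk,
      AddHom.coe_mk, Finset.sum_eq_single ⟨σ, γ⟩]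
    · simp only [if_true, map_one, one_smul]
    · intro γ' _ hγ'
      simp only [if_neg hγ', map_zero, zero_smul]
    · exact fun hn => absurd (Finset.mem_univ _) hn

open Filter Topology

theorem nonneg_of_frequently {a b : ℝ} (h : ∃ᶠ ε : ℝ in 𝓝[>] 0, 0 ≤ a + ε * b) :
    0 ≤ a ∧ (a = 0 → 0 ≤ b) := by
  constructor
  · by_contra! ha
    have hlim : Tendsto (fun ε : ℝ => a + ε * b) (𝓝[>] 0) (𝓝 (a + 0 * b)) :=
      Tendsto.mono_left (Continuous.tendsto (by fun_prop) 0) nhdsWithin_le_nhds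
    have : ∀ᶠ ε : ℝ in 𝓝[>] 0, a + ε * b < 0 := hlim.eventually (gt_mem_nhds (by simpa using ha))
    obtain ⟨ε, h1, h2⟩ := (h.and_eventually this).exists
    linarith
  · rintro rfl
    obtain ⟨ε, h1, h2⟩ := (h.and_eventually (eventually_mem_nhdsWithin (a := (0 : ℝ)))).exists
    rw [zero_add] at h1
    exact nonneg_of_mul_nonneg_right h1 h2

theorem eventually_nonneg {a b : ℝ} (ha : 0 ≤ a) (hb : a = 0 → 0 ≤ b) :
    ∀ᶠ ε : ℝ in 𝓝[>] 0, 0 ≤ a + ε * b := by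
  rcases ha.eq_or_lt with rfl | ha
  · filter_upwards [eventually_mem_nhdsWithin (a := (0 : ℝ))] with ε hε
    rw [zero_add]
    exact mul_nonneg (le_of_lt hε) (hb rfl)
  · have hlim : Tendsto (fun ε : ℝ => a + ε * b) (𝓝[>] 0) (𝓝 (a + 0 * b)) :=
      Tendsto.mono_left (Continuous.tendsto (by fun_prop) 0) nhdsWithin_le_nhds
    filter_upwards [hlim.eventually (lt_mem_nhds (show 0 < a + 0 * b by simpa using ha))] with ε hε
    exact hε.le

theorem eventually_add_smul_notMem {V : Type*} [AddCommGroup V] [Module ℝ V]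
    {W : Submodule ℝ V} {x q : V} (h : x ∉ W ∨ q ∉ W) :
    ∀ᶠ δ : ℝ in 𝓝[>] 0, x + δ • q ∉ W := by
  by_cases hq : q ∈ W
  · refine Eventually.of_forall fun δ hδ => h.elim (fun hx => hx ?_) fun hq' => hq' hq
    exact (Submodule.add_mem_iff_left _ (W.smul_mem δ hq)).1 hδ
  by_cases hex : ∃ δ : ℝ, 0 < δ ∧ x + δ • q ∈ W
  · obtain ⟨δ₀, hpos, hδ₀⟩ := hex
    filter_upwards [nhdsWithin_le_nhds (gt_mem_nhds hpos)] with δ hlt hδ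
    have h1 := sub_mem hδ hδ₀
    rw [add_sub_add_left_eq_sub, ← sub_smul, Submodule.smul_mem_iff _ (by linarith [hlt])] at h1
    exact hq h1
  · push Not at hex
    filter_upwards [eventually_mem_nhdsWithin (a := (0 : ℝ))] with δ hδ
    exact hex δ hδ

section Cones

variable {N : Type*} [AddCommGroup N] {k : ℕ} {v : Fin k → N}

theorem smul_mem_cone {I : Finset (Fin k)} {x : RealSpan N} {c : ℝ} (hc : 0 ≤ c)
    (hx : x ∈ cone v I) : c • x ∈ cone v I := by
  obtain ⟨a, ha, ha', rfl⟩ := hx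
  exact ⟨c • a, fun i => mul_nonneg hc (ha i), fun i hi => by simp [ha' i hi],
    by simp [Finset.smul_sum, mul_smul]⟩

theorem generator_mem_cone {I : Finset (Fin k)} {i : Fin k} (hi : i ∈ I) :
    toReal (v i) ∈ cone v I := by
  refine ⟨Pi.single i 1, fun j => ?_, fun j hj => ?_, ?_⟩
  · by_cases h : j = i
    · subst h; simp
    · simp [h]
  · simp [show j ≠ i by rintro rfl; exact hj hi]
  · rw [Finset.sum_eq_single i]
    · simp
    · intro j _ h; simp [h]
    · simp

theorem cone_subset_span (I : Finset (Fin k)) :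
    cone v I ⊆ Submodule.span ℝ ((fun i => toReal (v i)) '' (I : Set (Fin k))) := by
  rintro _ ⟨a, _, ha', rfl⟩
  refine Submodule.sum_mem _ fun i _ => ?_
  by_cases hi : i ∈ I
  · exact Submodule.smul_mem _ _ (Submodule.subset_span ⟨i, hi, rfl⟩)
  · simp [ha' i hi]

theorem simplex_subset_cone (I : Finset (Fin k)) : simplex v I ⊆ cone v I := by
  refine convexHull_min ?_ ?_
  · rintro _ ⟨i, hi, rfl⟩
    exact generator_mem_cone hi
  · intro x hx y hy a b ha hb _
    exact add_mem_cone (smul_mem_cone ha hx) (smul_mem_cone hb hy)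

theorem exists_mem_cone_notMem
    (hspan : Submodule.span ℝ (Set.range fun i => toReal (v i)) = ⊤)
    (S : Finset (Submodule ℝ (RealSpan N))) (hS : ∀ W ∈ S, W ≠ ⊤) :
    ∃ p ∈ cone v Finset.univ, ∀ W ∈ S, p ∉ W := by
  classical
  induction S using Finset.induction_on with
  | empty => exact ⟨0, zero_mem_cone _, by simp⟩
  | insert W₀ S _ ih =>
    obtain ⟨p, hp, hpS⟩ := ih fun W hW => hS W (Finset.mem_insert_of_mem hW)
    obtain ⟨i, hi⟩ : ∃ i, toReal (v i) ∉ W₀ := by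
      by_contra! h
      apply hS W₀ (Finset.mem_insert_self _ _)
      rw [eq_top_iff, ← hspan, Submodule.span_le]
      rintro _ ⟨i, rfl⟩
      exact h i
    have h1 : ∀ W ∈ insert W₀ S, ∀ᶠ δ : ℝ in 𝓝[>] 0, p + δ • toReal (v i) ∉ W := by
      intro W hW
      refine eventually_add_smul_notMem ?_
      rcases Finset.mem_insert.1 hW with rfl | hW
      · exact Or.inr hi
      · exact Or.inl (hpS W hW)
    obtain ⟨δ, h2, h3⟩ := ((eventually_all_finset _).2 h1 |>.and
      (eventually_mem_nhdsWithin (a := (0 : ℝ)))).exists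
    exact ⟨_, add_mem_cone hp (smul_mem_cone (le_of_lt h3)
      (generator_mem_cone (Finset.mem_univ i))), h2⟩

/-- The real extension of a homomorphism `N → ℤ`. -/
noncomputable def realExtension (deg : N →+ ℤ) : RealSpan N →ₗ[ℝ] ℝ :=
  LinearMap.liftBaseChange ℝ ((Int.castAddHom ℝ).comp deg).toIntLinearMap

theorem realExtension_toReal (deg : N →+ ℤ) (n : N) : realExtension deg (toReal n) = deg n := by
  simp [realExtension, toReal_apply]

end Cones

namespace StackyFan

variable {N : Type*} [AddCommGroup N] {k : ℕ} {v : Fin k → N} (F : StackyFan v)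

/-- The full-dimensional cones of the fan. -/
abbrev Chamber : Type :=
  {I : Finset (Fin k) // I ∈ F.faces ∧
    Submodule.span ℝ ((fun i => toReal (v i)) '' (I : Set (Fin k))) = ⊤}

noncomputable instance : Fintype F.Chamber := Fintype.ofFinite _

variable {F}

theorem exists_coord (σ : F.Chamber) : ∃ c : RealSpan N →ₗ[ℝ] (Fin k → ℝ),
    (∀ i ∈ σ.1, c (toReal (v i)) = Pi.single i 1) ∧ (∀ x, ∀ i ∉ σ.1, c x i = 0) ∧
      ∀ x, ∑ i, c x i • toReal (v i) = x := by
  let b : Module.Basis σ.1 ℝ (RealSpan N) :=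
    Module.Basis.mk (v := fun i : σ.1 => toReal (v i)) (F.linearIndepOn σ.1 σ.2.1) (by
      have h := σ.2.2
      rw [Set.image_eq_range] at h
      exact h.ge)
  have hb : ∀ i, b i = toReal (v i) := fun i => Module.Basis.mk_apply _ _ i
  let c : RealSpan N →ₗ[ℝ] (Fin k → ℝ) := b.constr ℝ fun i => Pi.single i.1 1
  have hc : ∀ i ∈ σ.1, c (toReal (v i)) = Pi.single i 1 := fun i hi => by
    rw [show toReal (v i) = b ⟨i, hi⟩ from (hb ⟨i, hi⟩).symm, Module.Basis.constr_basis]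
  refine ⟨c, hc, fun x i hi => ?_, fun x => ?_⟩
  · have : LinearMap.proj i ∘ₗ c = 0 := b.ext fun j => by
      rw [hb, LinearMap.comp_apply, hc j j.2]
      simp [show i ≠ j by rintro rfl; exact hi j.2]
    exact congrArg (fun f => f x) this
  · have : (∑ i, (LinearMap.proj i ∘ₗ c).smulRight (toReal (v i))) = LinearMap.id :=
      b.ext fun j => by
        rw [hb, LinearMap.sum_apply, Finset.sum_eq_single j.1]
        · simp [hc j j.2]
        · intro i _ hi
          simp [hc j j.2, hi]
        · simp
    simpa using congrArg (fun f => f x) this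

/-- The coordinates of a vector with respect to the generators of a full-dimensional cone. -/
noncomputable def coord (σ : F.Chamber) : RealSpan N →ₗ[ℝ] (Fin k → ℝ) :=
  (exists_coord σ).choose

theorem coord_generator (σ : F.Chamber) {i : Fin k} (hi : i ∈ σ.1) :
    coord σ (toReal (v i)) = Pi.single i 1 :=
  (exists_coord σ).choose_spec.1 i hi

theorem coord_of_notMem (σ : F.Chamber) (x : RealSpan N) {i : Fin k} (hi : i ∉ σ.1) :
    coord σ x i = 0 :=
  (exists_coord σ).choose_spec.2.1 x i hi

theorem sum_coord (σ : F.Chamber) (x : RealSpan N) : ∑ i, coord σ x i • toReal (v i) = x :=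
  (exists_coord σ).choose_spec.2.2 x

theorem coord_sum (σ : F.Chamber) {a : Fin k → ℝ} (ha : ∀ i ∉ σ.1, a i = 0) :
    coord σ (∑ i, a i • toReal (v i)) = a := by
  have : ∀ i, coord σ (a i • toReal (v i)) = Pi.single i (a i) := fun i => by
    by_cases hi : i ∈ σ.1
    · rw [map_smul, coord_generator σ hi, ← Pi.single_smul, smul_eq_mul, mul_one]
    · simp [ha i hi]
  rw [map_sum, Finset.sum_congr rfl fun i _ => this i]
  exact Finset.univ_sum_single a

theorem mem_cone_iff (σ : F.Chamber) {x : RealSpan N} :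
    x ∈ cone v σ.1 ↔ ∀ i, 0 ≤ coord σ x i := by
  constructor
  · rintro ⟨a, ha, ha', rfl⟩
    rw [coord_sum σ ha']
    exact ha
  · exact fun h => ⟨_, h, fun i hi => coord_of_notMem σ x hi, sum_coord σ x⟩

theorem coord_eq_zero (σ : F.Chamber) {x : RealSpan N} (hx : x ∈ cone v σ.1)
    {I : Finset (Fin k)} (hI : I ∈ F.faces) (hxI : x ∈ cone v I) {i : Fin k} (hi : i ∉ I) :
    coord σ x i = 0 := by
  have : x ∈ cone v (σ.1 ∩ I) := by rw [← F.inter σ.1 σ.2.1 I hI]; exact ⟨hx, hxI⟩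
  obtain ⟨a, _, ha', rfl⟩ := this
  rw [coord_sum σ fun j hj => ha' j fun h => hj (Finset.mem_inter.1 h).1]
  exact ha' i fun h => hi (Finset.mem_inter.1 h).2

theorem support_eq_cone (hT : IsRegularTriangulation v F.faces) :
    F.support = cone v Finset.univ := by
  apply Set.Subset.antisymm
  · intro x hx
    obtain ⟨I, _, hxI⟩ := F.mem_support.1 hx
    exact cone_mono (Finset.subset_univ I) hxI
  · rintro x ⟨a, ha, -, rfl⟩
    rcases (Finset.sum_nonneg fun i _ => ha i).eq_or_lt with hs | hs
    · have : ∀ i, a i = 0 := fun i =>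
        (Finset.sum_eq_zero_iff_of_nonneg fun i _ => ha i).1 hs.symm i (Finset.mem_univ i)
      exact F.mem_support.2 ⟨∅, F.empty_mem, by simpa [this] using zero_mem_cone ∅⟩
    · have hmem : ∑ i, (a i / ∑ j, a j) • toReal (v i) ∈ polytope v := by
        refine (convex_convexHull ℝ _).sum_mem (fun i _ => div_nonneg (ha i) hs.le) ?_
          fun i _ => subset_convexHull ℝ _ ⟨i, rfl⟩
        rw [← Finset.sum_div, div_self hs.ne']
      rw [← hT.covers] at hmem
      simp only [Set.mem_iUnion] at hmem
      obtain ⟨I, hI, hxI⟩ := hmem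
      refine F.mem_support.2 ⟨I, hI, ?_⟩
      have := smul_mem_cone hs.le (simplex_subset_cone I hxI)
      rw [Finset.smul_sum] at this
      simpa only [smul_smul, mul_div_cancel₀ _ hs.ne'] using this

theorem exists_chamber_of_frequently {x ξ : RealSpan N}
    (h : ∃ᶠ ε : ℝ in 𝓝[>] 0, ∃ σ : F.Chamber, x + ε • ξ ∈ cone v σ.1) :
    ∃ σ : F.Chamber, ∀ i, 0 ≤ coord σ x i ∧ (coord σ x i = 0 → 0 ≤ coord σ ξ i) := by
  obtain ⟨σ, hσ⟩ := frequently_exists.1 h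
  refine ⟨σ, fun i => nonneg_of_frequently (hσ.mono fun ε hε => ?_)⟩
  simpa using (mem_cone_iff σ).1 hε i

variable (hT : IsRegularTriangulation v F.faces)
  (hspan : Submodule.span ℝ (Set.range fun i => toReal (v i)) = ⊤)

include hT in
theorem exists_chamber_mem_of_generic {p : RealSpan N} (hp : p ∈ F.support)
    (hgen : ∀ I : Finset (Fin k),
      Submodule.span ℝ ((fun i => toReal (v i)) '' (I : Set (Fin k))) ≠ ⊤ →
      p ∉ Submodule.span ℝ ((fun i => toReal (v i)) '' (I : Set (Fin k))))
    {x : RealSpan N} (hx : x ∈ F.support) : ∃ σ : F.Chamber, x ∈ cone v σ.1 := by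
  have h1 : ∀ᶠ δ : ℝ in 𝓝[>] 0, ∀ I : Finset (Fin k),
      Submodule.span ℝ ((fun i => toReal (v i)) '' (I : Set (Fin k))) ≠ ⊤ →
      x + δ • p ∉ Submodule.span ℝ ((fun i => toReal (v i)) '' (I : Set (Fin k))) := by
    rw [eventually_all]
    intro I
    by_cases hI : Submodule.span ℝ ((fun i => toReal (v i)) '' (I : Set (Fin k))) = ⊤
    · simp [hI]
    · filter_upwards [eventually_add_smul_notMem (Or.inr (hgen I hI))] with δ hδ _ using hδ
  have h2 : ∀ᶠ δ : ℝ in 𝓝[>] 0, ∃ σ : F.Chamber, x + δ • p ∈ cone v σ.1 := by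
    filter_upwards [h1, eventually_mem_nhdsWithin (a := (0 : ℝ))] with δ hδ hpos
    have hmem : x + δ • p ∈ F.support := by
      rw [support_eq_cone hT] at hx hp ⊢
      exact add_mem_cone hx (smul_mem_cone (le_of_lt hpos) hp)
    obtain ⟨I, hI, hxI⟩ := F.mem_support.1 hmem
    refine ⟨⟨I, hI, ?_⟩, hxI⟩
    by_contra hne
    exact hδ I hne (cone_subset_span I hxI)
  obtain ⟨σ, hσ⟩ := exists_chamber_of_frequently h2.frequently
  exact ⟨σ, (mem_cone_iff σ).2 fun i => (hσ i).1⟩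

include hT hspan in
theorem exists_generic : ∃ p ∈ F.support, (∀ I : Finset (Fin k),
      Submodule.span ℝ ((fun i => toReal (v i)) '' (I : Set (Fin k))) ≠ ⊤ →
      p ∉ Submodule.span ℝ ((fun i => toReal (v i)) '' (I : Set (Fin k)))) ∧
    ∀ σ : F.Chamber, ∀ i ∈ σ.1, coord σ p i ≠ 0 := by
  classical
  let S₁ : Finset (Submodule ℝ (RealSpan N)) := (Finset.univ.image fun I : Finset (Fin k) =>
    Submodule.span ℝ ((fun i => toReal (v i)) '' (I : Set (Fin k)))).filter (· ≠ ⊤)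
  let S₂ : Finset (Submodule ℝ (RealSpan N)) := Finset.univ.image fun s : Σ σ : F.Chamber, σ.1 =>
    LinearMap.ker (LinearMap.proj s.2.1 ∘ₗ coord s.1)
  obtain ⟨p, hp, hpS⟩ := exists_mem_cone_notMem hspan (S₁ ∪ S₂) fun W hW => by
    rcases Finset.mem_union.1 hW with h | h
    · exact (Finset.mem_filter.1 h).2
    · obtain ⟨⟨σ, i⟩, -, rfl⟩ := Finset.mem_image.1 h
      intro htop
      have : toReal (v i) ∈ LinearMap.ker (LinearMap.proj i.1 ∘ₗ coord σ) := by
        rw [htop]; trivial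
      simp [coord_generator σ i.2] at this
  refine ⟨p, by rwa [support_eq_cone hT], fun I hI => hpS _ ?_, fun σ i hi h => ?_⟩
  · exact Finset.mem_union_left _ (Finset.mem_filter.2 ⟨Finset.mem_image_of_mem _
      (Finset.mem_univ I), hI⟩)
  · exact hpS _ (Finset.mem_union_right _ (Finset.mem_image_of_mem _
      (Finset.mem_univ (⟨σ, i, hi⟩ : Σ σ : F.Chamber, σ.1)))) h

include hT hspan in
theorem exists_chamber_mem {x : RealSpan N} (hx : x ∈ F.support) :
    ∃ σ : F.Chamber, x ∈ cone v σ.1 := by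
  obtain ⟨p, hp, hgen, -⟩ := exists_generic hT hspan
  exact exists_chamber_mem_of_generic hT hp hgen hx

/-- The point `x` lies in the half-open cone obtained from the full-dimensional cone `σ` by
removing the facets through which the direction `ξ` leaves `σ`. -/
def HalfOpen (ξ : RealSpan N) (σ : F.Chamber) (x : RealSpan N) : Prop :=
  ∀ i ∈ σ.1, 0 ≤ coord σ x i ∧ (coord σ x i = 0 → 0 < coord σ ξ i)

theorem HalfOpen.mem_cone {ξ x : RealSpan N} {σ : F.Chamber} (h : HalfOpen ξ σ x) :
    x ∈ cone v σ.1 := by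
  rw [mem_cone_iff]
  intro i
  by_cases hi : i ∈ σ.1
  · exact (h i hi).1
  · rw [coord_of_notMem σ x hi]

include hT hspan in
theorem exists_generic_direction (ξ : RealSpan N) : ∃ η : RealSpan N,
    (∀ x, (∃ σ : F.Chamber, HalfOpen η σ x) ↔
      x ∈ F.support ∧ ∀ᶠ ε : ℝ in 𝓝[>] 0, x + ε • ξ ∈ F.support) ∧
    ∀ x y, F.Joined y x → (∃ σ : F.Chamber, HalfOpen η σ x) →
      ∃ σ : F.Chamber, HalfOpen η σ (y + x) := by
  obtain ⟨p, hp, -, hcoord⟩ := exists_generic hT hspan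
  have hev : ∀ᶠ δ : ℝ in 𝓝[>] 0, ∀ σ : F.Chamber, ∀ i : σ.1,
      coord σ (ξ + δ • p) i ≠ 0 ∧ (coord σ ξ i < 0 → coord σ (ξ + δ • p) i < 0) := by
    rw [eventually_all]
    intro σ
    rw [eventually_all]
    intro i
    refine Eventually.and ?_ ?_
    · exact eventually_add_smul_notMem
        (W := LinearMap.ker (LinearMap.proj i.1 ∘ₗ coord σ)) (Or.inr (hcoord σ i i.2))
    · by_cases hneg : coord σ ξ i < 0
      · have hlim : Tendsto (fun δ : ℝ => coord σ ξ i + δ * coord σ p i) (𝓝[>] 0)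
            (𝓝 (coord σ ξ i + 0 * coord σ p i)) :=
          Tendsto.mono_left (Continuous.tendsto (by fun_prop) 0) nhdsWithin_le_nhds
        filter_upwards [hlim.eventually (gt_mem_nhds (show _ < (0 : ℝ) by simpa using hneg))]
          with δ hδ _
        simpa using hδ
      · simp [hneg]
  obtain ⟨δ, hδ, hpos⟩ := (hev.and (eventually_mem_nhdsWithin (a := (0 : ℝ)))).exists
  have hiff : ∀ x, (∃ σ : F.Chamber, HalfOpen (ξ + δ • p) σ x) ↔
      x ∈ F.support ∧ ∀ᶠ ε : ℝ in 𝓝[>] 0, x + ε • ξ ∈ F.support := by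
    intro x
    constructor
    · rintro ⟨σ, hσ⟩
      refine ⟨F.mem_support.2 ⟨σ.1, σ.2.1, hσ.mem_cone⟩, ?_⟩
      have : ∀ᶠ ε : ℝ in 𝓝[>] 0, ∀ i : σ.1, 0 ≤ coord σ x i + ε * coord σ ξ i := by
        rw [eventually_all]
        intro i
        refine eventually_nonneg (hσ i i.2).1 fun h0 => ?_
        by_contra! hneg
        have h1 := (hσ i i.2).2 h0
        have h2 := (hδ σ i).2 hneg
        linarith
      filter_upwards [this] with ε hε
      refine F.mem_support.2 ⟨σ.1, σ.2.1, (mem_cone_iff σ).2 fun i => ?_⟩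
      by_cases hi : i ∈ σ.1
      · simpa using hε ⟨i, hi⟩
      · rw [coord_of_notMem σ _ hi]
    · rintro ⟨hx, hev⟩
      have : ∀ᶠ ε : ℝ in 𝓝[>] 0, ∃ σ : F.Chamber, x + ε • (ξ + δ • p) ∈ cone v σ.1 := by
        filter_upwards [hev, eventually_mem_nhdsWithin (a := (0 : ℝ))] with ε hε hεpos
        apply exists_chamber_mem hT hspan
        rw [smul_add, ← add_assoc]
        rw [support_eq_cone hT] at hε hp ⊢
        exact add_mem_cone hε (smul_mem_cone (le_of_lt hεpos) (smul_mem_cone (le_of_lt hpos) hp))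
      obtain ⟨σ, hσ⟩ := exists_chamber_of_frequently this.frequently
      exact ⟨σ, fun i hi => ⟨(hσ i).1, fun h0 =>
        lt_of_le_of_ne ((hσ i).2 h0) (hδ σ ⟨i, hi⟩).1.symm⟩⟩
  refine ⟨ξ + δ • p, hiff, fun x y hxy hx => ?_⟩
  obtain ⟨-, h2⟩ := (hiff x).1 hx
  refine (hiff _).2 ⟨hxy.add_mem, ?_⟩
  obtain ⟨I, hI, hy, -⟩ := hxy
  filter_upwards [h2] with ε hε
  rw [add_assoc]
  rw [support_eq_cone hT] at hε ⊢
  exact add_mem_cone (cone_mono (Finset.subset_univ I) hy) hε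

theorem chamber_eq_of_subset {σ σ' : F.Chamber} (h : σ.1 ⊆ σ'.1) : σ = σ' := by
  refine Subtype.ext (Finset.Subset.antisymm h fun i hi => ?_)
  by_contra hn
  have h1 := coord_sum σ' (a := coord σ (toReal (v i))) fun j hj =>
    coord_of_notMem σ _ fun hj' => hj (h hj')
  rw [sum_coord, coord_generator σ' hi] at h1
  have := congrFun h1 i
  rw [coord_of_notMem σ _ hn] at this
  simp at this

include hT in
theorem exists_height (deg : N →+ ℤ) (hdeg : ∀ i, deg (v i) = 1) (η : RealSpan N) :
    ∃ h : F.Chamber → ℝ, ∀ σ σ' x, HalfOpen η σ x → x ∈ cone v σ'.1 → σ' ≠ σ → h σ' < h σ := by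
  obtain ⟨ω, hω⟩ := hT.regular
  have hℓ : ∀ σ : F.Chamber, ∃ ℓ : RealSpan N →ₗ[ℝ] ℝ, (∀ i ∈ σ.1, ℓ (toReal (v i)) = ω i) ∧
      ∀ i ∉ σ.1, ℓ (toReal (v i)) < ω i := fun σ => by
    obtain ⟨φ, c, h1, h2⟩ := (hω σ.1).1 σ.2.1
    have hval : ∀ i, (φ + c • realExtension deg) (toReal (v i)) = φ (toReal (v i)) + c :=
      fun i => by simp [realExtension_toReal, hdeg]
    exact ⟨φ + c • realExtension deg, fun i hi => by rw [hval, h1 i hi],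
      fun i hi => by rw [hval]; exact h2 i hi⟩
  choose ℓ hℓ1 hℓ2 using hℓ
  refine ⟨fun σ => ℓ σ η, fun σ σ' x hx hx' hne => ?_⟩
  have hexp : ∀ τ : F.Chamber, ℓ τ η = ∑ i, coord σ η i * ℓ τ (toReal (v i)) := fun τ => by
    conv_lhs => rw [← sum_coord σ η]
    simp
  have hpos : ∀ i ∈ σ.1, i ∉ σ'.1 → 0 < coord σ η i := fun i hi hi' =>
    (hx i hi).2 (coord_eq_zero σ hx.mem_cone σ'.2.1 hx' hi')
  obtain ⟨i₀, hi₀, hi₀'⟩ : ∃ i ∈ σ.1, i ∉ σ'.1 := by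
    by_contra! h
    exact hne (chamber_eq_of_subset h).symm
  change ℓ σ' η < ℓ σ η
  rw [hexp, hexp]
  refine Finset.sum_lt_sum (fun i _ => ?_) ⟨i₀, Finset.mem_univ _, ?_⟩
  · by_cases hi : i ∈ σ.1
    · rw [hℓ1 σ i hi]
      by_cases hi' : i ∈ σ'.1
      · rw [hℓ1 σ' i hi']
      · exact mul_le_mul_of_nonneg_left (hℓ2 σ' i hi').le (hpos i hi hi').le
    · simp [coord_of_notMem σ η hi]
  · rw [hℓ1 σ i₀ hi₀]
    exact mul_lt_mul_of_pos_left (hℓ2 σ' i₀ hi₀') (hpos i₀ hi₀ hi₀')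

end StackyFan

theorem exists_predual {N : Type*} [AddCommGroup N] [Module.Free ℤ N] [Module.Finite ℤ N] {d : ℕ}
    (g : Module.Basis (Fin d) ℤ (Module.Dual ℤ N)) : ∃ b : Module.Basis (Fin d) ℤ N,
    (∀ j l, g j (b l) = if j = l then 1 else 0) ∧ ∀ n, ∑ j, g j n • b j = n := by
  let b : Module.Basis (Fin d) ℤ N := g.dualBasis.map (Module.evalEquiv ℤ N).symm
  have hb : ∀ j l, g j (b l) = if j = l then 1 else 0 := fun j l => by
    have : g j (b l) = Module.evalEquiv ℤ N (b l) (g j) := rfl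
    rw [this, Module.Basis.map_apply, LinearEquiv.apply_symm_apply, Module.Basis.dualBasis_apply_self]
  refine ⟨b, hb, fun n => ?_⟩
  conv_rhs => rw [← b.sum_repr n]
  refine Finset.sum_congr rfl fun j _ => ?_
  congr 1
  conv_lhs => rw [← b.sum_repr n]
  simp only [map_sum, map_smul, hb, smul_eq_mul, mul_ite, mul_one, mul_zero]
  simp

namespace StackyFan

variable {N : Type*} [AddCommGroup N] {k : ℕ} {v : Fin k → N} {F : StackyFan v}

/-- The sublattice generated by the generators of a full-dimensional cone. -/
def Chamber.sublattice (σ : F.Chamber) : Submodule ℤ N :=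
  Submodule.span ℤ (v '' (σ.1 : Set (Fin k)))

theorem generator_mem_sublattice (σ : F.Chamber) {i : Fin k} (hi : i ∈ σ.1) :
    v i ∈ σ.sublattice :=
  Submodule.subset_span ⟨i, hi, rfl⟩

theorem sum_mem_sublattice (σ : F.Chamber) {a : Fin k → ℤ} (ha : ∀ i ∉ σ.1, a i = 0) :
    ∑ i, a i • v i ∈ σ.sublattice := by
  refine Submodule.sum_mem _ fun i _ => ?_
  by_cases hi : i ∈ σ.1
  · exact Submodule.smul_mem _ _ (generator_mem_sublattice σ hi)
  · simp [ha i hi]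

theorem mkQ_sum (σ : F.Chamber) {a : Fin k → ℤ} (ha : ∀ i ∉ σ.1, a i = 0) :
    σ.sublattice.mkQ (∑ i, a i • v i) = 0 :=
  (Submodule.Quotient.mk_eq_zero _).2 (sum_mem_sublattice σ ha)

theorem mem_sublattice {σ : F.Chamber} {n : N} (hn : n ∈ σ.sublattice) :
    ∃ a : Fin k → ℤ, (∀ i ∉ σ.1, a i = 0) ∧ ∑ i, a i • v i = n := by
  classical
  induction hn using Submodule.span_induction with
  | mem x hx =>
    obtain ⟨i, hi, rfl⟩ := hx
    refine ⟨Pi.single i 1, fun j hj => ?_, ?_⟩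
    · simp [show j ≠ i by rintro rfl; exact hj hi]
    · rw [Finset.sum_eq_single i]
      · simp
      · intro j _ h; simp [h]
      · simp
  | zero => exact ⟨0, by simp, by simp⟩
  | add x y _ _ hx hy =>
    obtain ⟨a, ha, rfl⟩ := hx
    obtain ⟨b, hb, rfl⟩ := hy
    exact ⟨a + b, fun i hi => by simp [ha i hi, hb i hi], by
      simp [add_smul, Finset.sum_add_distrib]⟩
  | smul c x _ hx =>
    obtain ⟨a, ha, rfl⟩ := hx
    exact ⟨c • a, fun i hi => by simp [ha i hi], by simp [mul_smul, Finset.smul_sum]⟩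

theorem coord_toReal_sum (σ : F.Chamber) {a : Fin k → ℤ} (ha : ∀ i ∉ σ.1, a i = 0)
    (i : Fin k) : coord σ (toReal (∑ i, a i • v i)) i = a i := by
  have : toReal (∑ i, a i • v i) = ∑ i, (a i : ℝ) • toReal (v i) := by
    rw [map_sum]
    refine Finset.sum_congr rfl fun i _ => ?_
    rw [map_zsmul, Int.cast_smul_eq_zsmul]
  rw [this, coord_sum σ fun i hi => by simp [ha i hi]]

open Classical in
/-- The integral part of the `i`-th coordinate of `n + χ`, where the fractional part is taken in
`[0, 1)` if the `i`-th coordinate of `η` is positive and in `(0, 1]` otherwise. -/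
noncomputable def integralPart (χ η : RealSpan N) (σ : F.Chamber) (n : N) (i : Fin k) : ℤ :=
  if i ∈ σ.1 then
    if 0 < coord σ η i then ⌊coord σ (toReal n + χ) i⌋ else ⌈coord σ (toReal n + χ) i⌉ - 1
  else 0

section IntegralPart

variable {χ η : RealSpan N}

theorem integralPart_of_notMem {σ : F.Chamber} {n : N} {i : Fin k} (hi : i ∉ σ.1) :
    integralPart χ η σ n i = 0 := if_neg hi

theorem integralPart_add (σ : F.Chamber) (n : N) {a : Fin k → ℤ} (ha : ∀ i ∉ σ.1, a i = 0)
    (i : Fin k) : integralPart χ η σ (n + ∑ i, a i • v i) i = integralPart χ η σ n i + a i := by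
  have : coord σ (toReal (n + ∑ i, a i • v i) + χ) i = coord σ (toReal n + χ) i + a i := by
    rw [map_add toReal, add_right_comm, map_add (coord σ), Pi.add_apply, coord_toReal_sum σ ha]
  by_cases hi : i ∈ σ.1
  · simp only [integralPart, if_pos hi, this, Int.floor_add_intCast, Int.ceil_add_intCast]
    split_ifs
    · rfl
    · ring
  · simp [integralPart_of_notMem hi, ha i hi]

theorem halfOpen_iff_integralPart {σ : F.Chamber} {n : N} :
    HalfOpen η σ (toReal n + χ) ↔ ∀ i, 0 ≤ integralPart χ η σ n i := by
  refine forall_congr' fun i => ?_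
  by_cases hi : i ∈ σ.1
  · simp only [integralPart, hi, forall_const]
    by_cases hpos : 0 < coord σ η i
    · simp [hpos, Int.floor_nonneg]
    · simp only [hpos, if_false, if_true]
      rw [sub_nonneg, Int.one_le_ceil_iff]
      constructor
      · rintro ⟨h1, h2⟩
        exact lt_of_le_of_ne h1 fun h => h2 h.symm
      · exact fun h => ⟨h.le, fun h' => absurd h' h.ne'⟩
  · simp [hi, integralPart_of_notMem hi]

/-- The representative of a class modulo the sublattice of `σ` whose translate by `χ` lies in the
half-open parallelepiped spanned by the generators of `σ`. -/
noncomputable def boxPoint (χ η : RealSpan N) (σ : F.Chamber) (c : N ⧸ σ.sublattice) : N :=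
  c.out + ∑ i, (-integralPart χ η σ c.out i) • v i

theorem mk_boxPoint (σ : F.Chamber) (c : N ⧸ σ.sublattice) :
    σ.sublattice.mkQ (boxPoint χ η σ c) = c := by
  rw [boxPoint, map_add, mkQ_sum σ fun i hi => by rw [integralPart_of_notMem hi, neg_zero],
    add_zero]
  exact Quotient.out_eq' c

theorem integralPart_boxPoint (σ : F.Chamber) (c : N ⧸ σ.sublattice) (i : Fin k) :
    integralPart χ η σ (boxPoint χ η σ c) i = 0 := by
  rw [boxPoint, integralPart_add σ _ fun i hi => by rw [integralPart_of_notMem hi, neg_zero]]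
  ring

open Classical in
/-- The translate of a box point by a nonnegative combination of the generators of `σ`. -/
noncomputable def conePoint (χ η : RealSpan N) (σ : F.Chamber) (c : N ⧸ σ.sublattice)
    (m : σ.1 →₀ ℕ) : N :=
  boxPoint χ η σ c + ∑ i, (if hi : i ∈ σ.1 then (m ⟨i, hi⟩ : ℤ) else 0) • v i

theorem mk_conePoint (σ : F.Chamber) (c : N ⧸ σ.sublattice) (m : σ.1 →₀ ℕ) :
    σ.sublattice.mkQ (conePoint χ η σ c m) = c := by
  rw [conePoint, map_add, mk_boxPoint, mkQ_sum σ fun i hi => by rw [dif_neg hi], add_zero]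

theorem integralPart_conePoint (σ : F.Chamber) (c : N ⧸ σ.sublattice) (m : σ.1 →₀ ℕ)
    (i : σ.1) : integralPart χ η σ (conePoint χ η σ c m) i = m i := by
  rw [conePoint, integralPart_add σ _ fun i hi => by rw [dif_neg hi], integralPart_boxPoint,
    zero_add, dif_pos i.2]

theorem halfOpen_conePoint {σ : F.Chamber}
    (c : N ⧸ σ.sublattice) (m : σ.1 →₀ ℕ) : HalfOpen η σ (toReal (conePoint χ η σ c m) + χ) := by
  rw [halfOpen_iff_integralPart]
  intro i
  by_cases hi : i ∈ σ.1
  · rw [integralPart_conePoint σ c m ⟨i, hi⟩]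
    positivity
  · rw [integralPart_of_notMem hi]

theorem exists_conePoint_eq {σ : F.Chamber} {n : N}
    (h : HalfOpen η σ (toReal n + χ)) : ∃ c m, conePoint χ η σ c m = n := by
  rw [halfOpen_iff_integralPart] at h
  have hmem : n - boxPoint χ η σ (σ.sublattice.mkQ n) ∈ σ.sublattice := by
    rw [← Submodule.Quotient.mk_eq_zero, ← Submodule.mkQ_apply, map_sub, mk_boxPoint, sub_self]
  obtain ⟨a, ha, hsum⟩ := mem_sublattice hmem
  have hn : n = boxPoint χ η σ (σ.sublattice.mkQ n) + ∑ i, a i • v i := by rw [hsum]; abel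
  have hpart : ∀ i, integralPart χ η σ n i = a i := fun i => by
    conv_lhs => rw [hn]
    rw [integralPart_add σ _ ha, integralPart_boxPoint, zero_add]
  refine ⟨σ.sublattice.mkQ n, Finsupp.equivFunOnFinite.symm fun i => (a i).toNat, ?_⟩
  conv_rhs => rw [hn]
  rw [conePoint]
  congr 1
  refine Finset.sum_congr rfl fun i _ => ?_
  by_cases hi : i ∈ σ.1
  · rw [dif_pos hi, Finsupp.equivFunOnFinite_symm_apply_apply, Int.toNat_of_nonneg (hpart i ▸ h i)]
  · rw [dif_neg hi, ha i hi]

theorem conePoint_injective {σ : F.Chamber} {c c' : N ⧸ σ.sublattice} {m m' : σ.1 →₀ ℕ}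
    (h : conePoint χ η σ c m = conePoint χ η σ c' m') : c = c' ∧ m = m' := by
  constructor
  · rw [← mk_conePoint (χ := χ) (η := η) σ c m, h, mk_conePoint]
  · ext i
    have := integralPart_conePoint (χ := χ) (η := η) σ c m i
    rw [h, integralPart_conePoint] at this
    exact_mod_cast this.symm

theorem conePoint_add_single (σ : F.Chamber) (c : N ⧸ σ.sublattice) (m : σ.1 →₀ ℕ) (i : σ.1) :
    conePoint χ η σ c (m + Finsupp.single i 1) = v i + conePoint χ η σ c m := by
  classical
  have : v i = ∑ j, (if j = i.1 then (1 : ℤ) else 0) • v j := by simp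
  rw [conePoint, conePoint, add_left_comm, this, ← Finset.sum_add_distrib]
  congr 1
  refine Finset.sum_congr rfl fun j _ => ?_
  rw [← add_smul]
  congr 1
  by_cases hj : j ∈ σ.1
  · by_cases hij : j = i.1
    · subst hij
      simp [add_comm]
    · have : (⟨j, hj⟩ : σ.1) ≠ i := fun h => hij (congrArg Subtype.val h)
      simp [hj, hij, this.symm]
  · simp [hj, show j ≠ i.1 by rintro rfl; exact hj i.2]

end IntegralPart

theorem smul_monoMod {χ : RealSpan N} {m n : N} (h : F.Joined (toReal m) (toReal n + χ)) :
    F.mono m • F.monoMod χ n = F.monoMod χ (m + n) := by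
  obtain ⟨I, hI, hm, hn⟩ := h
  exact (actMap_mono (F.mem_support.2 ⟨I, hI, hm⟩) (F.mem_support.2 ⟨I, hI, hn⟩)).trans
    (if_pos ⟨I, hI, hm, hn⟩)

theorem smul_monoMod_of_not_joined {χ : RealSpan N} {m n : N}
    (hm : toReal m ∈ F.support) (hn : toReal n + χ ∈ F.support)
    (h : ¬ F.Joined (toReal m) (toReal n + χ)) : F.mono m • F.monoMod χ n = 0 :=
  (actMap_mono hm hn).trans (if_neg h)

theorem restrictScalars_span_monoMod {χ : RealSpan N} {G : Set N}
    (hG : ∀ n ∈ G, toReal n + χ ∈ F.support)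
    (hadd : ∀ n ∈ G, ∀ m, F.Joined (toReal m) (toReal n + χ) → m + n ∈ G) :
    (Submodule.span F.SRRing (F.monoMod χ '' G)).restrictScalars ℂ =
      Submodule.span ℂ (F.monoMod χ '' G) := by
  apply le_antisymm
  · have hsmul : ∀ r : F.SRRing, ∀ y ∈ Submodule.span ℂ (F.monoMod χ '' G),
        r • y ∈ Submodule.span ℂ (F.monoMod χ '' G) := by
      intro r y hy
      induction hy using Submodule.span_induction with
      | mem y hy =>
        obtain ⟨n, hn, rfl⟩ := hy
        have hr : r ∈ Submodule.span ℂ (Set.range F.ringBasis) := by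
          rw [F.ringBasis.span_eq]; trivial
        induction hr using Submodule.span_induction with
        | mem r hr =>
          obtain ⟨m, rfl⟩ := hr
          rw [show F.ringBasis m = F.mono m.1 by rw [mono, dif_pos m.2]]
          by_cases h : F.Joined (toReal m.1) (toReal n + χ)
          · rw [smul_monoMod h]
            exact Submodule.subset_span ⟨_, hadd n hn _ h, rfl⟩
          · rw [smul_monoMod_of_not_joined m.2 (hG n hn) h]
            exact zero_mem _
        | zero => rw [zero_smul]; exact zero_mem _
        | add r r' _ _ hr hr' => rw [add_smul]; exact add_mem hr hr'
        | smul a r _ hr => rw [smul_assoc]; exact Submodule.smul_mem _ _ hr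
      | zero => rw [smul_zero]; exact zero_mem _
      | add y y' _ _ hy hy' => rw [smul_add]; exact add_mem hy hy'
      | smul a y _ hy => rw [smul_comm r a y]; exact Submodule.smul_mem _ _ hy
    intro y hy
    rw [Submodule.restrictScalars_mem] at hy
    induction hy using Submodule.span_induction with
    | mem y hy => exact Submodule.subset_span hy
    | zero => exact zero_mem _
    | add y y' _ _ hy hy' => exact add_mem hy hy'
    | smul r y _ hy => exact hsmul r y hy
  · rw [Submodule.span_le]
    exact fun y hy => Submodule.subset_span hy

end StackyFan

namespace StackyFan

variable {N : Type*} [AddCommGroup N] {k : ℕ} {v : Fin k → N} {F : StackyFan v}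

theorem generator_ne_zero {i : Fin k} (hi : {i} ∈ F.faces) : toReal (v i) ≠ 0 :=
  (F.linearIndepOn {i} hi).ne_zero (by simp)

theorem mem_of_generator_mem_cone {i : Fin k} (hi : {i} ∈ F.faces) {I : Finset (Fin k)}
    (hI : I ∈ F.faces) (h : toReal (v i) ∈ cone v I) : i ∈ I := by
  by_contra hn
  have : toReal (v i) ∈ cone v ({i} ∩ I) := by
    rw [← F.inter _ hi _ hI]
    exact ⟨generator_mem_cone (Finset.mem_singleton_self i), h⟩
  rw [Finset.singleton_inter_of_notMem hn] at this
  obtain ⟨a, _, ha, h0⟩ := this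
  exact generator_ne_zero hi (by rw [← h0]; simp [ha])

theorem singleton_mem_faces (σ : F.Chamber) {i : Fin k} (hi : i ∈ σ.1) : {i} ∈ F.faces :=
  F.down_closed σ.1 σ.2.1 _ (Finset.singleton_subset_iff.2 hi)

open Classical in
/-- The class of the `i`-th vector in `ℂ[Σ]` if it generates a ray, and `0` otherwise. -/
noncomputable def rayGenerator (F : StackyFan v) (i : Fin k) : F.SRRing :=
  if {i} ∈ F.faces then F.mono (v i) else 0

theorem idealZ_eq {d : ℕ} (g : Fin d → Module.Dual ℤ N) : F.idealZ g =
    Ideal.span (Set.range fun j => ∑ i, (g j (v i) : ℂ) • F.rayGenerator i) := by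
  rw [idealZ]
  congr
  ext1 j
  rw [Finset.sum_filter]
  refine Finset.sum_congr rfl fun i _ => ?_
  rw [rayGenerator]
  split_ifs <;> simp

/-- The index set of the monomial basis of a shadow module adapted to the half-open
decomposition. -/
abbrev ShadowIndex (F : StackyFan v) : Type _ :=
  Σ σ : F.Chamber, (N ⧸ σ.sublattice) × (σ.1 →₀ ℕ)

section Basis

variable {χ ξ η : RealSpan N}
  (hη : ∀ x, (∃ σ : F.Chamber, HalfOpen η σ x) ↔
      x ∈ F.support ∧ ∀ᶠ ε : ℝ in 𝓝[>] 0, x + ε • ξ ∈ F.support)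
  (hadd : ∀ x y, F.Joined y x → (∃ σ : F.Chamber, HalfOpen η σ x) →
      ∃ σ : F.Chamber, HalfOpen η σ (y + x))
  {h : F.Chamber → ℝ}
  (hh : ∀ σ σ' x, HalfOpen η σ x → x ∈ cone v σ'.1 → σ' ≠ σ → h σ' < h σ)

include hh in
theorem halfOpen_unique {σ σ' : F.Chamber} {x : RealSpan N} (hx : HalfOpen η σ x)
    (hx' : HalfOpen η σ' x) : σ = σ' := by
  by_contra hne
  have h1 := hh σ σ' x hx hx'.mem_cone (Ne.symm hne)
  have h2 := hh σ' σ x hx' hx.mem_cone hne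
  linarith

/-- The lattice point attached to an index. -/
noncomputable def shadowPoint (χ η : RealSpan N) (s : F.ShadowIndex) : N :=
  conePoint χ η s.1 s.2.1 s.2.2

theorem halfOpen_shadowPoint (s : F.ShadowIndex) :
    HalfOpen η s.1 (toReal (shadowPoint χ η s) + χ) :=
  halfOpen_conePoint s.2.1 s.2.2

include hh in
theorem shadowPoint_injective : Function.Injective (shadowPoint χ η : F.ShadowIndex → N) := by
  rintro ⟨σ, c, m⟩ ⟨σ', c', m'⟩ heq
  have h1 := halfOpen_shadowPoint (χ := χ) (η := η) ⟨σ, c, m⟩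
  have h2 := halfOpen_shadowPoint (χ := χ) (η := η) ⟨σ', c', m'⟩
  rw [heq] at h1
  obtain rfl : σ = σ' := halfOpen_unique hh h1 h2
  obtain ⟨rfl, rfl⟩ := conePoint_injective heq
  rfl

theorem range_shadowPoint : Set.range (shadowPoint χ η : F.ShadowIndex → N) =
    {n | ∃ σ : F.Chamber, HalfOpen η σ (toReal n + χ)} := by
  ext n
  constructor
  · rintro ⟨s, rfl⟩
    exact ⟨s.1, halfOpen_shadowPoint s⟩
  · rintro ⟨σ, hσ⟩
    obtain ⟨c, m, rfl⟩ := exists_conePoint_eq hσ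
    exact ⟨⟨σ, c, m⟩, rfl⟩

include hη in
theorem shadow_eq_span : F.shadow χ ξ = Submodule.span F.SRRing
    (F.monoMod χ '' Set.range (shadowPoint χ η : F.ShadowIndex → N)) := by
  rw [shadow, range_shadowPoint]
  congr 1
  ext y
  constructor
  · rintro ⟨n, h1, h2, rfl⟩
    exact ⟨n, (hη _).2 ⟨h1, h2⟩, rfl⟩
  · rintro ⟨n, hn, rfl⟩
    exact ⟨n, ((hη _).1 hn).1, ((hη _).1 hn).2, rfl⟩

include hη in
theorem monoMod_shadowPoint_mem (s : F.ShadowIndex) :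
    F.monoMod χ (shadowPoint χ η s) ∈ F.shadow χ ξ := by
  rw [shadow_eq_span hη]
  exact Submodule.subset_span ⟨_, ⟨s, rfl⟩, rfl⟩

include hη hadd hh in
theorem exists_shadowBasis : ∃ b : Module.Basis F.ShadowIndex ℂ (F.shadow χ ξ),
    ∀ s, (b s : F.SRModule χ) = F.monoMod χ (shadowPoint χ η s) := by
  let f : F.ShadowIndex → F.shadow χ ξ := fun s => ⟨_, monoMod_shadowPoint_mem hη s⟩
  let ι : F.shadow χ ξ →ₗ[ℂ] F.SRModule χ := (F.shadow χ ξ).subtype.restrictScalars ℂ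
  have hι : Function.Injective ι := Subtype.val_injective
  have hsupp : ∀ s : F.ShadowIndex, toReal (shadowPoint χ η s) + χ ∈ F.support := fun s =>
    ((hη _).1 ⟨s.1, halfOpen_shadowPoint s⟩).1
  have hli : LinearIndependent ℂ f := by
    apply LinearIndependent.of_comp ι
    have : ι ∘ f = F.modBasis χ ∘ fun s => ⟨shadowPoint χ η s, hsupp s⟩ := by
      ext1 s
      change F.monoMod χ _ = _
      rw [monoMod, dif_pos (hsupp s)]
      rfl
    rw [this]
    refine (F.modBasis χ).linearIndependent.comp _ fun s s' hs => ?_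
    exact shadowPoint_injective hh (congrArg Subtype.val hs)
  have hsp : ⊤ ≤ Submodule.span ℂ (Set.range f) := by
    rintro x -
    have hx : ι x ∈ Submodule.map ι (Submodule.span ℂ (Set.range f)) := by
      rw [Submodule.map_span, ← Set.range_comp,
        show ι ∘ f = F.monoMod χ ∘ shadowPoint χ η from rfl, Set.range_comp,
        ← restrictScalars_span_monoMod, ← shadow_eq_span hη]
      · exact x.2
      · rintro _ ⟨s, rfl⟩
        exact hsupp s
      · rintro _ ⟨s, rfl⟩ m hm
        rw [range_shadowPoint]
        have := hadd _ _ hm ⟨s.1, halfOpen_shadowPoint s⟩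
        rwa [← add_assoc, ← map_add] at this
    obtain ⟨y, hy, hxy⟩ := hx
    rwa [← hι hxy]
  exact ⟨Module.Basis.mk hli hsp, fun s => by rw [Module.Basis.mk_apply]⟩

theorem rayGenerator_smul_of_mem {s : F.ShadowIndex} (i : s.1.1) :
    F.rayGenerator i • F.monoMod χ (shadowPoint χ η s) =
      F.monoMod χ (shadowPoint χ η ⟨s.1, s.2.1, s.2.2 + Finsupp.single i 1⟩) := by
  rw [rayGenerator, if_pos (singleton_mem_faces s.1 i.2), smul_monoMod, shadowPoint, shadowPoint,
    conePoint_add_single]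
  exact ⟨s.1.1, s.1.2.1, generator_mem_cone i.2, (halfOpen_shadowPoint s).mem_cone⟩

include hadd hh in
theorem rayGenerator_smul_of_notMem {s : F.ShadowIndex} {i : Fin k} (hi : i ∉ s.1.1) :
    F.rayGenerator i • F.monoMod χ (shadowPoint χ η s) = 0 ∨
      ∃ s' : F.ShadowIndex, h s'.1 < h s.1 ∧ F.rayGenerator i • F.monoMod χ (shadowPoint χ η s) =
        F.monoMod χ (shadowPoint χ η s') := by
  have hs := halfOpen_shadowPoint (χ := χ) (η := η) s
  by_cases hiF : {i} ∈ F.faces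
  · rw [rayGenerator, if_pos hiF]
    by_cases hj : F.Joined (toReal (v i)) (toReal (shadowPoint χ η s) + χ)
    · right
      obtain ⟨σ', hσ'⟩ := hadd _ _ hj ⟨s.1, hs⟩
      obtain ⟨I, hI, h1, h2⟩ := hj
      have h3 := mem_cone_of_add_mem F hI σ'.2.1 h1 h2 hσ'.mem_cone
      have h4 := mem_cone_of_add_mem F hI σ'.2.1 h2 h1 (by rw [add_comm]; exact hσ'.mem_cone)
      have hne : σ' ≠ s.1 := by
        rintro rfl
        exact hi (mem_of_generator_mem_cone hiF s.1.2.1 h3)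
      rw [← add_assoc, ← map_add] at hσ'
      obtain ⟨c, m, hcm⟩ := exists_conePoint_eq hσ'
      refine ⟨⟨σ', c, m⟩, hh _ _ _ hs h4 hne, ?_⟩
      rw [smul_monoMod ⟨I, hI, h1, h2⟩, ← hcm, shadowPoint]
    · left
      exact smul_monoMod_of_not_joined
        (F.mem_support.2 ⟨_, hiF, generator_mem_cone (Finset.mem_singleton_self i)⟩)
        (F.mem_support.2 ⟨_, s.1.2.1, hs.mem_cone⟩) hj
  · left
    rw [rayGenerator, if_neg hiF, zero_smul]

end Basis

theorem sublattice_linearIndependent (σ : F.Chamber) :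
    LinearIndependent ℤ fun i : σ.1 => v i := by
  have h : LinearIndependent ℝ fun i : σ.1 => toReal (v i) := F.linearIndepOn σ.1 σ.2.1
  exact LinearIndependent.of_comp (toReal : N →ₗ[ℤ] RealSpan N) (h.restrict_scalars' ℤ)

theorem card_chamber [Module.Free ℤ N] (σ : F.Chamber) : σ.1.card = Module.finrank ℤ N := by
  have h : LinearIndependent ℝ fun i : σ.1 => toReal (v i) := F.linearIndepOn σ.1 σ.2.1
  have hspan := σ.2.2
  rw [Set.image_eq_range] at hspan
  have := Module.finrank_eq_card_basis (Module.Basis.mk h hspan.ge)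
  rw [Module.finrank_baseChange] at this
  simpa using this.symm

variable [Module.Free ℤ N] [Module.Finite ℤ N]

instance finite_quotient_sublattice (σ : F.Chamber) : Finite (N ⧸ σ.sublattice) := by
  apply Submodule.finiteQuotientOfFreeOfRankEq
  have h := finrank_span_eq_card (sublattice_linearIndependent σ)
  rw [Fintype.card_coe, card_chamber σ] at h
  rw [Chamber.sublattice, Set.image_eq_range]
  exact h

theorem finrank_shadow_quotient (hT : IsRegularTriangulation v F.faces)
    (hspan : Submodule.span ℝ (Set.range fun i => toReal (v i)) = ⊤)
    (deg : N →+ ℤ) (hdeg : ∀ i, deg (v i) = 1) {d : ℕ}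
    (g : Module.Basis (Fin d) ℤ (Module.Dual ℤ N)) (χ ξ : RealSpan N) :
    Module.Finite ℂ (F.shadow χ ξ ⧸ (F.idealZ g • ⊤ : Submodule F.SRRing (F.shadow χ ξ))) ∧
      Module.finrank ℂ (F.shadow χ ξ ⧸ (F.idealZ g • ⊤ : Submodule F.SRRing (F.shadow χ ξ))) =
        ∑ σ : F.Chamber, Nat.card (N ⧸ σ.sublattice) := by
  classical
  obtain ⟨η, hη, hadd⟩ := exists_generic_direction hT hspan ξ
  obtain ⟨h, hh⟩ := exists_height hT deg hdeg η
  obtain ⟨e, he⟩ := exists_shadowBasis (χ := χ) hη hadd hh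
  obtain ⟨b, hgb, hb⟩ := exists_predual g
  let _ : ∀ σ : F.Chamber, Fintype (N ⧸ σ.sublattice) := fun σ => Fintype.ofFinite _
  have hbij := bijective_of_triangular (R := F.SRRing) (fun σ : F.Chamber => σ.1) h e
    F.rayGenerator (fun j i => (g j (v i) : ℂ)) (fun σ i j => ((coord σ (toReal (b j)) i : ℝ) : ℂ))
    (fun σ i hi i' hi' => by
      have h1 : ∑ j, coord σ (toReal (b j)) i * (g j (v i') : ℝ) = if i = i' then 1 else 0 := by
        have h2 : coord σ (toReal (v i')) i = if i = i' then 1 else 0 := by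
          rw [coord_generator σ hi', Pi.single_apply]
        rw [← h2]
        conv_rhs => rw [← hb (v i')]
        rw [map_sum, map_sum, Finset.sum_apply]
        refine Finset.sum_congr rfl fun j _ => ?_
        rw [map_zsmul, map_zsmul, Pi.smul_apply, zsmul_eq_mul, mul_comm]
      have h3 := congrArg Complex.ofReal h1
      rw [apply_ite Complex.ofReal] at h3
      simpa using h3)
    (fun σ j j' => by
      have h1 : ∑ i : σ.1, (g j (v i) : ℝ) * coord σ (toReal (b j')) i =
          if j = j' then 1 else 0 := by
        have h2 : realExtension (g j).toAddMonoidHom (toReal (b j')) = if j = j' then 1 else 0 := by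
          rw [realExtension_toReal]
          simp [hgb]
        rw [Finset.sum_coe_sort σ.1 fun i => (g j (v i) : ℝ) * coord σ (toReal (b j')) i,
          Finset.sum_subset (Finset.subset_univ σ.1) fun i _ hi => by
            rw [coord_of_notMem σ _ hi, mul_zero], ← h2]
        conv_rhs => rw [← sum_coord σ (toReal (b j'))]
        rw [map_sum]
        refine Finset.sum_congr rfl fun i _ => ?_
        rw [map_smul, realExtension_toReal, smul_eq_mul, mul_comm]
        rfl
      have h3 := congrArg Complex.ofReal h1
      rw [apply_ite Complex.ofReal] at h3
      simpa using h3)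
    (fun σ γ m i => Subtype.ext (by
      rw [Submodule.coe_smul, he, he]
      exact rayGenerator_smul_of_mem (s := ⟨σ, γ, m⟩) i))
    (fun σ γ m i hi => by
      rcases rayGenerator_smul_of_notMem hadd hh (s := ⟨σ, γ, m⟩) hi with h0 | ⟨s', hlt, h0⟩
      · rw [show F.rayGenerator i • e ⟨σ, γ, m⟩ = 0 from Subtype.ext (by
          rw [Submodule.coe_smul, he, h0, Submodule.coe_zero])]
        exact zero_mem _
      · exact Submodule.subset_span ⟨s'.1, s'.2.1, s'.2.2, hlt, Subtype.ext (by
          rw [Submodule.coe_smul, he, h0, he])⟩)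
  obtain ⟨h1, h2⟩ := finrank_quotient_of_bijective _ _ hbij
  rw [idealZ_eq]
  refine ⟨h1, h2.trans ?_⟩
  rw [Fintype.card_sigma]
  exact Finset.sum_congr rfl fun σ _ => Nat.card_eq_fintype_card.symm

end StackyFan

open MeasureTheory

theorem volume_standardSimplex (n : ℕ) {t : ℝ} (ht : 0 ≤ t) :
    volume {y : Fin n → ℝ | (∀ i, 0 ≤ y i) ∧ ∑ i, y i ≤ t} =
      ENNReal.ofReal (t ^ n / n.factorial) := by
  induction n generalizing t with
  | zero => simp [ht, volume_pi, Measure.pi_of_empty (x := (0 : Fin 0 → ℝ))]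
  | succ n ih =>
    let S' : Set (ℝ × (Fin n → ℝ)) := {x | (0 ≤ x.1 ∧ ∀ i, 0 ≤ x.2 i) ∧ x.1 + ∑ i, x.2 i ≤ t}
    have hmeas : MeasurableSet S' := by
      have h1 : IsClosed {x : ℝ × (Fin n → ℝ) | ∀ i, 0 ≤ x.2 i} := by
        rw [Set.ofPred_forall]
        exact isClosed_iInter fun i => isClosed_le continuous_const (by fun_prop)
      have h2 : IsClosed {x : ℝ × (Fin n → ℝ) | x.1 + ∑ i, x.2 i ≤ t} :=
        isClosed_le (by fun_prop) continuous_const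
      exact (((isClosed_le continuous_const continuous_fst).inter h1).inter h2).measurableSet
    have hpre : {y : Fin (n + 1) → ℝ | (∀ i, 0 ≤ y i) ∧ ∑ i, y i ≤ t} =
        MeasurableEquiv.piFinSuccAbove (fun _ => ℝ) 0 ⁻¹' S' := by
      ext y
      simp [S', MeasurableEquiv.piFinSuccAbove_apply, Fin.forall_fin_succ, Fin.sum_univ_succ,
        Fin.tail]
    have hslice : ∀ a : ℝ, volume (Prod.mk a ⁻¹' S') =
        (Set.Icc 0 t).indicator (fun a => ENNReal.ofReal ((t - a) ^ n / n.factorial)) a := by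
      intro a
      by_cases ha : a ∈ Set.Icc 0 t
      · rw [Set.indicator_of_mem ha, ← ih (sub_nonneg.2 ha.2)]
        congr 1
        ext y
        simp [S', ha.1, le_sub_iff_add_le']
      · rw [Set.indicator_of_notMem ha]
        convert measure_empty (μ := (volume : Measure (Fin n → ℝ)))
        rw [Set.eq_empty_iff_forall_notMem]
        rintro y ⟨⟨h1, h2⟩, h3⟩
        have : 0 ≤ ∑ i, y i := Finset.sum_nonneg fun i _ => h2 i
        exact ha ⟨h1, by linarith⟩
    rw [hpre, (volume_preserving_piFinSuccAbove (fun _ => ℝ) 0).measure_preimage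
      hmeas.nullMeasurableSet, Measure.volume_eq_prod, Measure.prod_apply hmeas,
      lintegral_congr hslice, lintegral_indicator measurableSet_Icc,
      ← ofReal_integral_eq_lintegral_ofReal]
    · congr 1
      rw [integral_Icc_eq_integral_Ioc, ← intervalIntegral.integral_of_le ht,
        intervalIntegral.integral_div,
        intervalIntegral.integral_comp_sub_left (fun x => x ^ n) t, integral_pow]
      rw [Nat.factorial_succ]
      push_cast
      simp
      field_simp
    · exact (Continuous.integrableOn_Icc (by fun_prop))
    · filter_upwards [ae_restrict_mem measurableSet_Icc] with a ha
      have := sub_nonneg.2 ha.2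
      positivity

section Simplices

variable {N : Type*} [AddCommGroup N] {k : ℕ} {v : Fin k → N} {deg : N →+ ℤ}

theorem mem_simplex_iff (hdeg : ∀ i, deg (v i) = 1) {I : Finset (Fin k)} {x : RealSpan N} :
    x ∈ simplex v I ↔ x ∈ cone v I ∧ realExtension deg x = 1 := by
  constructor
  · refine fun hx => ⟨simplex_subset_cone I hx, ?_⟩
    have : simplex v I ⊆ {x | realExtension deg x = 1} := by
      refine convexHull_min ?_ (convex_hyperplane (realExtension deg).isLinear 1)
      rintro _ ⟨i, _, rfl⟩
      simp [realExtension_toReal, hdeg]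
    exact this hx
  · rintro ⟨⟨a, ha, ha', rfl⟩, h1⟩
    simp only [map_sum, map_smul, realExtension_toReal, hdeg, Int.cast_one, smul_eq_mul,
      mul_one] at h1
    rw [← Finset.sum_subset (Finset.subset_univ I) fun i _ hi => ha' i hi] at h1
    rw [← Finset.sum_subset (Finset.subset_univ I) fun i _ hi => by rw [ha' i hi, zero_smul]]
    exact (convex_convexHull ℝ _).sum_mem (fun i _ => ha i) h1
      fun i hi => subset_convexHull ℝ _ ⟨i, hi, rfl⟩

theorem polytope_eq_simplex : polytope v = simplex v Finset.univ := by
  rw [polytope, simplex, Finset.coe_univ, Set.image_univ]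

theorem toReal_sum_smul (a : Fin k → ℤ) :
    toReal (∑ i, a i • v i) = ∑ i, (a i : ℝ) • toReal (v i) := by
  rw [map_sum]
  exact Finset.sum_congr rfl fun i _ => by rw [map_zsmul, Int.cast_smul_eq_zsmul]

theorem exists_sum_smul_eq (hgen : AddSubgroup.closure (Set.range v) = ⊤) (n : N) :
    ∃ a : Fin k → ℤ, ∑ i, a i • v i = n := by
  have hn : n ∈ Submodule.span ℤ (Set.range v) := by
    rw [← Submodule.mem_toAddSubgroup, Submodule.span_int_eq_addSubgroupClosure, hgen]
    trivial
  exact (Submodule.mem_span_range_iff_exists_fun ℤ).1 hn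

theorem span_eq_top_of_closure (hgen : AddSubgroup.closure (Set.range v) = ⊤) :
    Submodule.span ℝ (Set.range fun i => toReal (v i)) = ⊤ := by
  rw [eq_top_iff]
  rintro x -
  induction x using TensorProduct.induction_on with
  | zero => exact zero_mem _
  | add x y hx hy => exact add_mem hx hy
  | tmul c n =>
    obtain ⟨a, rfl⟩ := exists_sum_smul_eq hgen n
    rw [show c ⊗ₜ[ℤ] (∑ i, a i • v i) = c • toReal (∑ i, a i • v i) by
      rw [toReal_apply, TensorProduct.smul_tmul', smul_eq_mul, mul_one], toReal_sum_smul]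
    exact Submodule.smul_mem _ _ (Submodule.sum_mem _ fun i _ =>
      Submodule.smul_mem _ _ (Submodule.subset_span ⟨i, rfl⟩))

theorem mem_directionLattice_polytope (hk : 0 < k)
    (hgen : AddSubgroup.closure (Set.range v) = ⊤) (hdeg : ∀ i, deg (v i) = 1) {n : N} :
    n ∈ directionLattice (polytope v) ↔ deg n = 0 := by
  change toReal n ∈ vectorSpan ℝ (polytope v) ↔ _
  have hvs : vectorSpan ℝ (polytope v) = vectorSpan ℝ (Set.range fun i => toReal (v i)) := by
    rw [polytope, ← direction_affineSpan, affineSpan_convexHull, direction_affineSpan]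
  rw [hvs]
  constructor
  · intro hn
    have hle : vectorSpan ℝ (Set.range fun i => toReal (v i)) ≤
        LinearMap.ker (realExtension deg) := by
      rw [vectorSpan, Submodule.span_le]
      rintro _ ⟨_, ⟨i, rfl⟩, _, ⟨j, rfl⟩, rfl⟩
      simp [realExtension_toReal, hdeg]
    have := LinearMap.mem_ker.1 (hle hn)
    rw [realExtension_toReal] at this
    exact_mod_cast this
  · intro hn
    obtain ⟨a, rfl⟩ := exists_sum_smul_eq hgen n
    have hsum : ∑ i, (a i : ℝ) = 0 := by
      rw [map_sum] at hn
      simp only [map_zsmul, hdeg, smul_eq_mul, mul_one] at hn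
      exact_mod_cast hn
    have : toReal (∑ i, a i • v i) =
        ∑ i, (a i : ℝ) • (toReal (v i) - toReal (v ⟨0, hk⟩)) := by
      simp only [smul_sub, Finset.sum_sub_distrib, ← Finset.sum_smul, hsum, zero_smul, sub_zero]
      exact toReal_sum_smul a
    rw [this]
    exact Submodule.sum_mem _ fun i _ => Submodule.smul_mem _ _
      (vsub_mem_vectorSpan ℝ ⟨i, rfl⟩ ⟨⟨0, hk⟩, rfl⟩)

end Simplices

namespace StackyFan

variable {N : Type*} [AddCommGroup N] {k : ℕ} {v : Fin k → N} {F : StackyFan v} {deg : N →+ ℤ}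

theorem sum_coord_eq (hdeg : ∀ i, deg (v i) = 1) (σ : F.Chamber) (x : RealSpan N) :
    ∑ i, coord σ x i = realExtension deg x := by
  conv_rhs => rw [← sum_coord σ x]
  simp [realExtension_toReal, hdeg]

theorem mem_simplex_iff_coord (hdeg : ∀ i, deg (v i) = 1) (σ : F.Chamber) {x : RealSpan N}
    (hx : realExtension deg x = 1) : x ∈ simplex v σ.1 ↔ ∀ i, 0 ≤ coord σ x i := by
  rw [mem_simplex_iff hdeg, mem_cone_iff, and_iff_left hx]

variable {r : ℕ} {K : Submodule ℤ N} (b : Module.Basis (Fin r) ℤ K)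

/-- The linear map `ℝ^r → N ⊗ ℝ` given by a basis of a sublattice. -/
noncomputable def parametrization : (Fin r → ℝ) →ₗ[ℝ] RealSpan N :=
  Fintype.linearCombination ℝ fun i => toReal (b i : N)

theorem parametrization_apply (x : Fin r → ℝ) :
    parametrization b x = ∑ i, x i • toReal (b i : N) := rfl

theorem toReal_eq_parametrization (n : K) :
    toReal (n : N) = parametrization b fun i => (b.repr n i : ℝ) := by
  rw [parametrization_apply]
  conv_lhs => rw [← b.sum_repr n]
  rw [Submodule.coe_sum, map_sum]
  exact Finset.sum_congr rfl fun i _ => by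
    rw [Submodule.coe_smul, map_zsmul, Int.cast_smul_eq_zsmul]

variable (hK : ∀ n, n ∈ K ↔ deg n = 0)

include hK in
theorem realExtension_parametrization (x : Fin r → ℝ) :
    realExtension deg (parametrization b x) = 0 := by
  rw [parametrization_apply, map_sum]
  refine Finset.sum_eq_zero fun i _ => ?_
  rw [map_smul, realExtension_toReal, (hK _).1 (b i).2]
  simp

include hK in
theorem exists_parametrization_eq (hdeg : ∀ i, deg (v i) = 1) (hk : 0 < k) (σ : F.Chamber)
    {y : RealSpan N} (hy : realExtension deg y = 0) : ∃ x, parametrization b x = y := by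
  change y ∈ LinearMap.range (parametrization b)
  have : y = ∑ i, coord σ y i • toReal (v i - v ⟨0, hk⟩) := by
    simp only [map_sub, smul_sub, Finset.sum_sub_distrib, ← Finset.sum_smul,
      sum_coord_eq hdeg, hy, zero_smul, sub_zero]
    exact (sum_coord σ y).symm
  rw [this]
  refine Submodule.sum_mem _ fun i _ => Submodule.smul_mem _ _ ?_
  exact ⟨_, (toReal_eq_parametrization b ⟨v i - v ⟨0, hk⟩, (hK _).2 (by simp [hdeg])⟩).symm⟩

include hK in
theorem card_quotient_eq (hdeg : ∀ i, deg (v i) = 1) (hk : 0 < k) (σ : F.Chamber) :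
    Nat.card (N ⧸ σ.sublattice) = Nat.card (K ⧸ σ.sublattice.comap K.subtype) := by
  obtain ⟨i₀, hi₀⟩ : σ.1.Nonempty := by
    rw [Finset.nonempty_iff_ne_empty]
    intro h0
    have h1 := sum_coord_eq hdeg σ (toReal (v ⟨0, hk⟩))
    rw [Finset.sum_eq_zero fun i _ => coord_of_notMem σ _ (by simp [h0]),
      realExtension_toReal, hdeg] at h1
    simp at h1
  let f : K →ₗ[ℤ] N ⧸ σ.sublattice := σ.sublattice.mkQ ∘ₗ K.subtype
  have hf : Function.Surjective f := by
    intro c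
    obtain ⟨n, rfl⟩ := σ.sublattice.mkQ_surjective c
    refine ⟨⟨n - deg n • v i₀, (hK _).2 (by simp [hdeg])⟩, ?_⟩
    change σ.sublattice.mkQ (n - deg n • v i₀) = _
    rw [map_sub, sub_eq_self]
    exact (Submodule.Quotient.mk_eq_zero _).2
      (Submodule.smul_mem _ _ (generator_mem_sublattice σ hi₀))
  have hker : LinearMap.ker f = σ.sublattice.comap K.subtype := by
    rw [LinearMap.ker_comp, Submodule.ker_mkQ]
  rw [← hker]
  exact (Nat.card_congr (f.quotKerEquivOfSurjective hf).toEquiv).symm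

end StackyFan

namespace StackyFan

variable {N : Type*} [AddCommGroup N] {k : ℕ} {v : Fin k → N} {F : StackyFan v} {deg : N →+ ℤ}

section Differences

variable {r : ℕ} {σ : F.Chamber} {i₀ : Fin k} (e : Fin r ≃ σ.1.erase i₀)

theorem sum_smul_differences {R M : Type*} [Ring R] [AddCommGroup M] [Module R M]
    (u : Fin k → M) (a : Fin k → R) (ha : ∀ i ∉ σ.1, a i = 0) :
    ∑ j, a (e j) • (u (e j) - u i₀) = ∑ i, a i • u i - (∑ i, a i) • u i₀ := by
  rw [e.sum_comp fun i : σ.1.erase i₀ => a i • (u i - u i₀),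
    Finset.sum_coe_sort (σ.1.erase i₀) fun i => a i • (u i - u i₀),
    Finset.sum_erase _ (by rw [sub_self, smul_zero]), Finset.sum_subset (Finset.subset_univ σ.1)
      fun i _ hi => by rw [ha i hi, zero_smul]]
  simp only [smul_sub, Finset.sum_sub_distrib, Finset.sum_smul]

open Classical in
theorem exists_extension (hi₀ : i₀ ∈ σ.1) {R : Type*} [Ring R] (c : Fin r → R) (s : R) :
    ∃ a : Fin k → R, (∀ j, a (e j) = c j) ∧ (∀ i ∉ σ.1, a i = 0) ∧ a i₀ = s - ∑ j, c j ∧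
      ∑ i, a i = s := by
  let a : Fin k → R := fun i => if hi : i ∈ σ.1.erase i₀ then c (e.symm ⟨i, hi⟩) else
    if i = i₀ then s - ∑ j, c j else 0
  have h1 : ∀ j, a (e j) = c j := fun j => by
    simp only [a]
    rw [dif_pos (e j).2]
    simp
  have h2 : ∀ i ∉ σ.1, a i = 0 := fun i hi => by
    simp only [a]
    rw [dif_neg fun h => hi (Finset.mem_of_mem_erase h), if_neg]
    rintro rfl
    exact hi hi₀
  have h3 : a i₀ = s - ∑ j, c j := by simp [a]
  refine ⟨a, h1, h2, h3, ?_⟩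
  rw [← Finset.sum_subset (Finset.subset_univ σ.1) fun i _ hi => h2 i hi,
    ← Finset.sum_erase_add _ _ hi₀, h3, ← Finset.sum_coe_sort (σ.1.erase i₀) a, ← e.sum_comp]
  simp [h1]

variable {K : Submodule ℤ N} (hK : ∀ n, n ∈ K ↔ deg n = 0) (hdeg : ∀ i, deg (v i) = 1)

include hK hdeg in
theorem difference_mem (i j : Fin k) : v i - v j ∈ K := (hK _).2 (by simp [hdeg])

include hK hdeg in
theorem exists_basis_comap_sublattice (hi₀ : i₀ ∈ σ.1) :
    ∃ bN : Module.Basis (Fin r) ℤ (σ.sublattice.comap K.subtype),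
      ∀ j, ((bN j : K) : N) = v (e j) - v i₀ := by
  let w : Fin r → σ.sublattice.comap K.subtype := fun j =>
    ⟨⟨v (e j) - v i₀, difference_mem hK hdeg _ _⟩, sub_mem
      (generator_mem_sublattice σ (Finset.mem_of_mem_erase (e j).2))
      (generator_mem_sublattice σ hi₀)⟩
  have hcoe : ∀ c : Fin r → ℤ, (((∑ j, c j • w j : σ.sublattice.comap K.subtype) : K) : N) =
      ∑ j, c j • (v (e j) - v i₀) := fun c => by simp [w]
  have hli : LinearIndependent ℤ w := by
    rw [Fintype.linearIndependent_iff]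
    intro c hc j
    obtain ⟨a, h1, h2, -, h4⟩ := exists_extension e hi₀ c 0
    have h5 := hcoe c
    simp only [← h1] at h5
    rw [sum_smul_differences e v a h2, h4, zero_smul, sub_zero] at h5
    simp only [h1, hc] at h5
    have h6 := coord_toReal_sum σ h2 (e j)
    rw [← h5] at h6
    rw [← h1]
    simpa using h6.symm
  have hsp : ⊤ ≤ Submodule.span ℤ (Set.range w) := by
    rintro ⟨⟨n, hn⟩, hnσ⟩ -
    obtain ⟨a, ha, hsum⟩ := mem_sublattice (σ := σ) (n := n) hnσ
    rw [Submodule.mem_span_range_iff_exists_fun]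
    refine ⟨fun j => a (e j), Subtype.ext (Subtype.ext ?_)⟩
    have h0 : ∑ i, a i = 0 := by
      have := (hK _).1 hn
      rw [← hsum, map_sum] at this
      simpa [hdeg] using this
    rw [hcoe, sum_smul_differences e v a ha, h0, zero_smul, sub_zero, hsum]
  exact ⟨Module.Basis.mk hli hsp, fun j => by rw [Module.Basis.mk_apply]⟩

variable [Module.Free ℤ N] [Module.Finite ℤ N] (b : Module.Basis (Fin r) ℤ K)

include hK hdeg in
theorem volume_preimage_simplex (hi₀ : i₀ ∈ σ.1) (e : Fin r ≃ σ.1.erase i₀) {p : RealSpan N}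
    (hp : realExtension deg p = 1) :
    volume {x | p + parametrization b x ∈ simplex v σ.1} =
      ENNReal.ofReal (Nat.card (N ⧸ σ.sublattice) / r.factorial) := by
  have hk : 0 < k := i₀.pos
  obtain ⟨bN, hbN⟩ := exists_basis_comap_sublattice e hK hdeg hi₀
  have hcard : (b.det fun j => (bN j : K)).natAbs = Nat.card (N ⧸ σ.sublattice) := by
    rw [card_quotient_eq hK hdeg hk]
    exact Submodule.natAbs_det_basis_change b _ bN
  let A : Matrix (Fin r) (Fin r) ℤ := b.toMatrix fun j => (bN j : K)
  let φ : (Fin r → ℝ) →ₗ[ℝ] (Fin r → ℝ) := Matrix.toLin' (A.map (Int.cast : ℤ → ℝ))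
  have hdet : |LinearMap.det φ| = Nat.card (N ⧸ σ.sublattice) := by
    have h1 : LinearMap.det φ = ((A.det : ℤ) : ℝ) := by
      rw [LinearMap.det_toLin']
      exact (RingHom.map_det (Int.castRingHom ℝ) A).symm
    rw [h1, ← hcard, Nat.cast_natAbs, Int.cast_abs]
    rfl
  have hdet0 : LinearMap.det φ ≠ 0 := by
    rw [← abs_pos, hdet]
    exact_mod_cast Nat.card_pos
  have hφ : ∀ y, parametrization b (φ y) = ∑ j, y j • (toReal (v (e j)) - toReal (v i₀)) := by
    intro y
    have h1 : φ y = ∑ j, y j • fun i => (b.repr (bN j : K) i : ℝ) := by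
      ext i
      simp only [φ, Matrix.toLin'_apply, Matrix.mulVec, dotProduct, Finset.sum_apply,
        Pi.smul_apply, smul_eq_mul]
      exact Finset.sum_congr rfl fun j _ => mul_comm _ _
    rw [h1, map_sum]
    refine Finset.sum_congr rfl fun j _ => ?_
    rw [map_smul, ← toReal_eq_parametrization, hbN, map_sub]
  obtain ⟨q, hq⟩ := exists_parametrization_eq b hK hdeg hk σ
    (y := toReal (v i₀) - p) (by rw [map_sub, realExtension_toReal, hdeg, hp]; simp)
  let T : Set (Fin r → ℝ) := {y | (∀ i, 0 ≤ y i) ∧ ∑ i, y i ≤ 1}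
  have hmem : ∀ y, p + parametrization b (q + φ y) ∈ simplex v σ.1 ↔ y ∈ T := by
    intro y
    obtain ⟨a, h1, h2, h3, h4⟩ := exists_extension e hi₀ y 1
    have h5 : p + parametrization b (q + φ y) = ∑ i, a i • toReal (v i) := by
      have h6 := sum_smul_differences e (fun i => toReal (v i)) a h2
      simp only [h1, h4, one_smul] at h6
      rw [map_add, hq, hφ, h6]
      abel
    have h7 : realExtension deg (p + parametrization b (q + φ y)) = 1 := by
      rw [map_add, hp, realExtension_parametrization b hK, add_zero]
    rw [mem_simplex_iff_coord hdeg σ h7, h5, coord_sum σ h2]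
    constructor
    · intro h
      refine ⟨fun j => by rw [← h1]; exact h _, ?_⟩
      have := h i₀
      rw [h3] at this
      linarith
    · rintro ⟨h8, h9⟩ i
      by_cases hi : i ∈ σ.1.erase i₀
      · have := h1 (e.symm ⟨i, hi⟩)
        rw [Equiv.apply_symm_apply] at this
        rw [this]
        exact h8 _
      · by_cases hi' : i = i₀
        · rw [hi', h3]
          linarith
        · rw [h2 i fun h => hi (Finset.mem_erase.2 ⟨hi', h⟩)]
  have hset : {x | p + parametrization b x ∈ simplex v σ.1} = (fun z => q + z) '' (φ '' T) := by
    ext x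
    constructor
    · intro hx
      obtain ⟨y, hy⟩ := (LinearMap.equivOfDetNeZero φ hdet0).surjective (x - q)
      have hy' : q + φ y = x := by
        rw [show φ y = x - q from hy]
        abel
      exact ⟨φ y, ⟨y, (hmem y).1 (by rw [hy']; exact hx), rfl⟩, hy'⟩
    · rintro ⟨_, ⟨y, hy, rfl⟩, rfl⟩
      exact (hmem y).2 hy
  rw [hset, Set.image_add_left, measure_preimage_add, Measure.addHaar_image_linearMap, hdet,
    volume_standardSimplex r zero_le_one, ← ENNReal.ofReal_mul (by positivity), one_pow,
    mul_one_div]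

end Differences

section Sum

variable {r : ℕ} {K : Submodule ℤ N} (hK : ∀ n, n ∈ K ↔ deg n = 0) (hdeg : ∀ i, deg (v i) = 1)
  (b : Module.Basis (Fin r) ℤ K) {p : RealSpan N} (hp : realExtension deg p = 1)

include hK hdeg hp in
theorem measurableSet_preimage_simplex (σ : F.Chamber) :
    MeasurableSet {x | p + parametrization b x ∈ simplex v σ.1} := by
  have h1 : ∀ x, realExtension deg (p + parametrization b x) = 1 := fun x => by
    rw [map_add, hp, realExtension_parametrization b hK, add_zero]
  simp only [mem_simplex_iff_coord hdeg σ (h1 _), Set.ofPred_forall]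
  refine (isClosed_iInter fun i => isClosed_le continuous_const ?_).measurableSet
  have h2 : Continuous (LinearMap.proj i ∘ₗ coord σ ∘ₗ parametrization b :
      (Fin r → ℝ) →ₗ[ℝ] ℝ) := LinearMap.continuous_of_finiteDimensional _
  simp only [map_add, Pi.add_apply]
  exact continuous_const.add h2

include hK hdeg hp in
theorem aedisjoint_preimage_simplex {σ σ' : F.Chamber} (hne : σ ≠ σ') :
    AEDisjoint volume {x | p + parametrization b x ∈ simplex v σ.1}
      {x | p + parametrization b x ∈ simplex v σ'.1} := by
  obtain ⟨i, hi, hi'⟩ : ∃ i ∈ σ.1, i ∉ σ'.1 := by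
    by_contra! h
    exact hne (chamber_eq_of_subset h)
  let H : AffineSubspace ℝ (Fin r → ℝ) :=
    { carrier := {x | coord σ (p + parametrization b x) i = 0}
      smul_vsub_vadd_mem' := fun c x y z hx hy hz => by
        simp only [Set.mem_ofPred_eq, map_add, Pi.add_apply, vsub_eq_sub, vadd_eq_add, map_smul,
          map_sub, Pi.smul_apply, Pi.sub_apply, smul_eq_mul] at hx hy hz ⊢
        linear_combination hz + c * (hx - hy) }
  have hH : H ≠ ⊤ := by
    intro htop
    obtain ⟨x, hx⟩ := exists_parametrization_eq b hK hdeg i.pos σ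
      (y := toReal (v i) - p) (by rw [map_sub, realExtension_toReal, hdeg, hp]; simp)
    have hxH : x ∈ H := by rw [htop]; trivial
    have : coord σ (p + parametrization b x) i = 0 := hxH
    rw [hx, add_sub_cancel, coord_generator σ hi] at this
    simp at this
  refine measure_mono_null (fun x hx => ?_) (Measure.addHaar_affineSubspace volume H hH)
  exact coord_eq_zero σ (simplex_subset_cone _ hx.1) σ'.2.1 (simplex_subset_cone _ hx.2) hi'

theorem polytope_eq_iUnion (hT : IsRegularTriangulation v F.faces)
    (hspan : Submodule.span ℝ (Set.range fun i => toReal (v i)) = ⊤)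
    (hdeg : ∀ i, deg (v i) = 1) : polytope v = ⋃ σ : F.Chamber, simplex v σ.1 := by
  ext x
  rw [polytope_eq_simplex, mem_simplex_iff hdeg, ← support_eq_cone hT, Set.mem_iUnion]
  constructor
  · rintro ⟨h1, h2⟩
    obtain ⟨σ, hσ⟩ := exists_chamber_mem hT hspan h1
    exact ⟨σ, (mem_simplex_iff hdeg).2 ⟨hσ, h2⟩⟩
  · rintro ⟨σ, hσ⟩
    obtain ⟨h1, h2⟩ := (mem_simplex_iff hdeg).1 hσ
    exact ⟨F.mem_support.2 ⟨σ.1, σ.2.1, h1⟩, h2⟩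

variable [Module.Free ℤ N] [Module.Finite ℤ N]

theorem sum_card_eq_normalizedVolume (hk : 0 < k)
    (hgen : AddSubgroup.closure (Set.range v) = ⊤) (hdeg : ∀ i, deg (v i) = 1)
    (hT : IsRegularTriangulation v F.faces) :
    ((∑ σ : F.Chamber, Nat.card (N ⧸ σ.sublattice) : ℕ) : ℝ) = normalizedVolume (polytope v) := by
  have hspan := span_eq_top_of_closure hgen
  have hne : (polytope v).Nonempty := ⟨_, subset_convexHull ℝ _ ⟨⟨0, hk⟩, rfl⟩⟩
  rw [normalizedVolume, dif_pos hne]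
  have hmem : ∀ y ∈ polytope v, realExtension deg y = 1 := fun y hy => by
    rw [polytope_eq_simplex] at hy
    exact ((mem_simplex_iff hdeg).1 hy).2
  have hp : realExtension deg hne.some = 1 := hmem _ hne.some_mem
  generalize hne.some = p at hp
  have hK : ∀ n, n ∈ directionLattice (polytope v) ↔ deg n = 0 := fun n =>
    mem_directionLattice_polytope hk hgen hdeg
  have hr : Module.finrank ℤ (directionLattice (polytope v)) + 1 = Module.finrank ℤ N := by
    have hker : directionLattice (polytope v) = LinearMap.ker deg.toIntLinearMap := by
      ext n
      rw [hK, LinearMap.mem_ker]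
      rfl
    have hsurj : Function.Surjective deg.toIntLinearMap := fun m =>
      ⟨m • v ⟨0, hk⟩, by simp [hdeg]⟩
    rw [hker, ← Submodule.finrank_quotient_add_finrank (LinearMap.ker deg.toIntLinearMap),
      (deg.toIntLinearMap.quotKerEquivOfSurjective hsurj).finrank_eq, Module.finrank_self, add_comm]
  let b := Module.finBasis ℤ (directionLattice (polytope v))
  have hvol : ∀ σ : F.Chamber, volume {x | p + parametrization b x ∈ simplex v σ.1} =
      ENNReal.ofReal (Nat.card (N ⧸ σ.sublattice) /
        (Module.finrank ℤ (directionLattice (polytope v))).factorial) := fun σ => by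
    have hcard := card_chamber σ
    obtain ⟨i₀, hi₀⟩ : σ.1.Nonempty := by
      rw [← Finset.card_pos]
      omega
    refine volume_preimage_simplex hK hdeg b hi₀ (Fintype.equivFinOfCardEq ?_).symm hp
    rw [Fintype.card_coe, Finset.card_erase_of_mem hi₀]
    omega
  have hunion : {x : Fin _ → ℝ | p + ∑ i, x i • toReal (b i : N) ∈ polytope v} =
      ⋃ σ : F.Chamber, {x | p + parametrization b x ∈ simplex v σ.1} := by
    have hpoly : ∀ y, y ∈ polytope v ↔ ∃ σ : F.Chamber, y ∈ simplex v σ.1 := fun y => by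
      rw [polytope_eq_iUnion hT hspan hdeg, Set.mem_iUnion]
    ext x
    rw [Set.mem_iUnion]
    exact hpoly _
  rw [parametrizedVolume, hunion, measure_iUnion₀
    (fun σ σ' hσ => aedisjoint_preimage_simplex hK hdeg b hp hσ)
    (fun σ => (measurableSet_preimage_simplex hK hdeg b hp σ).nullMeasurableSet), tsum_fintype,
    ENNReal.toReal_sum fun σ _ => by rw [hvol]; exact ENNReal.ofReal_ne_top, Finset.mul_sum]
  push_cast
  refine Finset.sum_congr rfl fun σ _ => ?_
  rw [hvol, ENNReal.toReal_ofReal (by positivity), mul_div_cancel₀]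
  positivity

end Sum

end StackyFan

/-- Isomorphic modules have isomorphic quotients by the multiples of an ideal. -/
noncomputable def quotientSMulTopEquiv {R M M' : Type*} [CommRing R] [Algebra ℂ R]
    [AddCommGroup M] [Module R M] [Module ℂ M] [IsScalarTower ℂ R M] [AddCommGroup M']
    [Module R M'] [Module ℂ M'] [IsScalarTower ℂ R M'] (I : Ideal R) (e : M ≃ₗ[R] M') :
    (M ⧸ (I • ⊤ : Submodule R M)) ≃ₗ[ℂ] (M' ⧸ (I • ⊤ : Submodule R M')) :=
  (Submodule.Quotient.equiv _ _ e (by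
    rw [Submodule.map_smul'', Submodule.map_top, LinearEquiv.range])).restrictScalars ℂ

namespace StackyFan

variable {N : Type*} [AddCommGroup N] {k : ℕ} {v : Fin k → N} (F : StackyFan v)

theorem shadow_zero_right {χ : RealSpan N} : F.shadow χ 0 = ⊤ := by
  rw [eq_top_iff]
  rintro x -
  have hx : x ∈ Submodule.span ℂ (Set.range (F.modBasis χ)) := by
    rw [(F.modBasis χ).span_eq]
    trivial
  induction hx using Submodule.span_induction with
  | mem x hx =>
    obtain ⟨n, rfl⟩ := hx
    exact Submodule.subset_span ⟨n.1, n.2, Filter.Eventually.of_forall fun ε => by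
      rw [smul_zero, add_zero]; exact n.2, by rw [monoMod, dif_pos n.2]⟩
  | zero => exact zero_mem _
  | add x y _ _ hx hy => exact add_mem hx hy
  | smul a x _ hx => exact Submodule.smul_of_tower_mem _ a hx

theorem bijective_smul_monoMod_zero :
    Function.Bijective (LinearMap.toSpanSingleton F.SRRing _ (F.monoMod 0 0)) := by
  let e : F.SRRing ≃ₗ[ℂ] F.SRModule 0 := F.ringBasis.equiv (F.modBasis 0)
    (Equiv.subtypeEquivRight fun n => by rw [add_zero])
  have he : e.toLinearMap =
      (LinearMap.toSpanSingleton F.SRRing _ (F.monoMod 0 0)).restrictScalars ℂ := by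
    refine F.ringBasis.ext fun n => ?_
    have h1 : F.ringBasis n = F.mono n.1 := by rw [mono, dif_pos n.2]
    have h2 : F.modBasis 0 ⟨n.1, by rw [add_zero]; exact n.2⟩ = F.monoMod 0 n.1 := by
      rw [monoMod, dif_pos]
    have h3 : F.Joined (toReal n.1) (toReal 0 + 0) := by
      rw [map_zero, add_zero]
      exact (F.joined_zero_left.2 n.2).symm
    rw [LinearMap.restrictScalars_apply, LinearMap.toSpanSingleton_apply, h1, smul_monoMod h3,
      add_zero, ← h1, ← h2]
    exact F.ringBasis.equiv_apply n (F.modBasis 0) _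
  have := e.bijective
  rwa [← LinearEquiv.coe_toLinearMap, he] at this

/-- The ring `ℂ[Σ]` is isomorphic to `ℂ[Σ; 0]` as a module. -/
noncomputable def ringEquivModule : F.SRRing ≃ₗ[F.SRRing] F.SRModule 0 :=
  LinearEquiv.ofBijective _ F.bijective_smul_monoMod_zero

end StackyFan

end StackyGKZ

theorem mainTheorem8 {N : Type*} [AddCommGroup N] [Module.Free ℤ N] [Module.Finite ℤ N]
    {d k : ℕ} (hk : 0 < k) (v : Fin k → N) (hv : Function.Injective v)
    (hgen : AddSubgroup.closure (Set.range v) = ⊤)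
    (deg : N →+ ℤ) (hdeg : ∀ i, deg (v i) = 1)
    (F : StackyGKZ.StackyFan v) (hF : StackyGKZ.IsRegularTriangulation v F.faces)
    (g : Module.Basis (Fin d) ℤ (Module.Dual ℤ N))
    (χ ξ : StackyGKZ.RealSpan N) :
    (Module.Finite ℂ (F.SRRing ⧸ F.idealZ g) ∧
      (Module.finrank ℂ (F.SRRing ⧸ F.idealZ g) : ℝ) =
        StackyGKZ.normalizedVolume (StackyGKZ.polytope v)) ∧
    (Module.Finite ℂ (F.SRModule χ ⧸ (F.idealZ g • ⊤ : Submodule F.SRRing (F.SRModule χ))) ∧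
      (Module.finrank ℂ
          (F.SRModule χ ⧸ (F.idealZ g • ⊤ : Submodule F.SRRing (F.SRModule χ))) : ℝ) =
        StackyGKZ.normalizedVolume (StackyGKZ.polytope v)) ∧
    (Module.Finite ℂ (F.shadow χ ξ ⧸ (F.idealZ g • ⊤ : Submodule F.SRRing (F.shadow χ ξ))) ∧
      (Module.finrank ℂ
          (F.shadow χ ξ ⧸ (F.idealZ g • ⊤ : Submodule F.SRRing (F.shadow χ ξ))) : ℝ) =
        StackyGKZ.normalizedVolume (StackyGKZ.polytope v)) := by
  have hspan := StackyGKZ.span_eq_top_of_closure hgen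
  have hvol := StackyGKZ.StackyFan.sum_card_eq_normalizedVolume hk hgen hdeg hF
  have key := fun χ ξ => StackyGKZ.StackyFan.finrank_shadow_quotient hF hspan deg hdeg g χ ξ
  have hmod : ∀ χ, Module.Finite ℂ (F.SRModule χ ⧸
        (F.idealZ g • ⊤ : Submodule F.SRRing (F.SRModule χ))) ∧
      Module.finrank ℂ (F.SRModule χ ⧸
        (F.idealZ g • ⊤ : Submodule F.SRRing (F.SRModule χ))) =
          ∑ σ : F.Chamber, Nat.card (N ⧸ σ.sublattice) := fun χ => by
    let e := StackyGKZ.quotientSMulTopEquiv (F.idealZ g)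
      (LinearEquiv.ofTop (F.shadow χ 0) F.shadow_zero_right)
    obtain ⟨h1, h2⟩ := key χ 0
    exact ⟨Module.Finite.equiv e, e.finrank_eq.symm.trans h2⟩
  refine ⟨?_, ?_, ?_⟩
  · let e := StackyGKZ.quotientSMulTopEquiv (F.idealZ g) F.ringEquivModule
    let e' : (F.SRRing ⧸ (F.idealZ g • ⊤ : Submodule F.SRRing F.SRRing)) ≃ₗ[ℂ]
        (F.SRRing ⧸ F.idealZ g) :=
      (Submodule.quotEquivOfEq _ _ (by rw [smul_eq_mul, Ideal.mul_top])).restrictScalars ℂ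
    obtain ⟨h1, h2⟩ := hmod 0
    exact ⟨Module.Finite.equiv (e.symm ≪≫ₗ e'),
      by rw [← (e.symm ≪≫ₗ e').finrank_eq, h2, hvol]⟩
  · exact ⟨(hmod χ).1, by rw [(hmod χ).2, hvol]⟩
  · exact ⟨(key χ ξ).1, by rw [(key χ ξ).2, hvol]⟩
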